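/- Setting. Let $X\in\mathbb R^{n\times p}$ have columns $X_1,\dots,X_p$, let $\sigma>0$ be known, and let $Y=X\beta^0+\eta$ with $\eta\sim\mathcal N_n(0,\sigma^2\mathrm{Id}_n)$. Fix $K$ with $1\le K<\min(n-3,\operatorname{rank}X)$ and integers $n_1,n_2\ge1$ with $n=n_1+n_2+K+1$. Run Least Angle Regression (LAR) on $(X,Y)$: $\lambda_1=\max_j|X_j^\top Y|$, attained at the variable $\bar\imath_1$, with sign $\varepsilon_1$ of $X_{\bar\imath_1}^\top Y$, and $N^{(1)}=X^\top Y$. Given $k$ entered variables $S=(\bar\imath_1,\dots,\bar\imath_k)$ and their signs $\varepsilon=(\varepsilon_1,\dots,\varepsilon_k)$, put $\bar\theta_j=X_j^\top X_S(X_S^\top X_S)^{-1}\varepsilon$ and $N_j(\beta)=N^{(k)}_j-(\lambda_k-\beta)\bar\theta_j$. Then $\lambda_{k+1}$ is the largest $\beta\in(0,\lambda_k]$ such that $|N_j(\beta)|=\beta$ for some $j\notin S$, the variable $\bar\imath_{k+1}$ maximizes $|N_j(\lambda_{k+1})|$ over $j\notin S$ (smallest index in case of ties), $\varepsilon_{k+1}$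 is the sign of $N_{\bar\imath_{k+1}}(\lambda_{k+1})$, and $N^{(k+1)}=N(\lambda_{k+1})$. Write $\hat\imath_k=(\bar\imath_k,\varepsilon_k)$ for the signed variables, $\lambda_0=\infty$, and $H_a=\mathrm{Span}(X_{\bar\imath_1},\dots,X_{\bar\imath_a})$ (so $H_0=\{0\}$). Irrepresentable Check. A sequence of signed variables $(j_1,s_1),\dots,(j_K,s_K)$ with distinct $j_1,\dots,j_K$ satisfies it if for every $1\le k\le K$, with $T=(j_1,\dots,j_k)$, $X_T^\top X_T$ is invertible and $|X_j^\top X_T(X_T^\top X_T)^{-1}(s_1,\dots,s_k)^\top|<1$ for every $j\notin\{j_1,\dots,j_k\}$. Stopping rule. Let $\hat\sigma_{\mathrm{select}}=\|P_{E_1}Y\|_2/\sqrt{n_1}$, where $P_{E_1}$ is the orthogonal projection onto $E_1$, the $n_1$-dimensional space among the projections of $\mathrm{Span}(e_1,\dots,e_\ell)$, $\ell\ge0$, onto the orthogonal complement of $\mathrm{Span}(X_{\bar\imath_1},\dots,X_{\bar\imath_{K+1}})$. A selection rule $\hat m\in\{0,\dots,K-1\}$ satisfies the stopping-time condition if for every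 $0\le a\le K-1$ the indicator of $\{\hat m\le a\}$ is a measurable function of $(\lambda_1,\dots,\lambda_a,\hat\imath_1,\dots,\hat\imath_{K+1},\hat\sigma_{\mathrm{select}})$. The statistic. For a signed variable $i=(j,s)$ let $R_{i,i'}=ss'X_j^\top X_{j'}$. For $1\le k\le K+1$ let $M=(R_{\hat\imath_l,\hat\imath_m})_{l,m<k}$, $r=(R_{\hat\imath_k,\hat\imath_l})_{l<k}$, and $$\rho_k=\frac{\sqrt{R_{\hat\imath_k,\hat\imath_k}-r^\top M^{-1}r}}{1-r^\top M^{-1}(1,\dots,1)^\top}\qquad(\rho_1=\sqrt{R_{\hat\imath_1,\hat\imath_1}}).$$ Let $\Phi_k$ be the distribution function of $\mathcal N(0,\sigma^2\rho_k^2)$, $F_k=\Phi_k(\lambda_k)$, $\mathcal P_{i,j}=\Phi_i\circ\Phi_j^{-1}$, with the conventions $F_0=1$, $\mathcal P_{i,0}(1)=1$. Let $$\mathcal I_{ab}(s,t)=\int_{\mathcal P_{a+1,b}(t)}^{\mathcal P_{a+1,a}(s)}df_{a+1}\int_{\mathcal P_{a+2,b}(t)}^{\mathcal P_{a+2,a+1}(f_{a+1})}df_{a+2}\cdots\int_{\mathcal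 P_{b-1,b}(t)}^{\mathcal P_{b-1,b-2}(f_{b-2})}df_{b-1},\qquad \mathcal I_{a,a+1}=1,$$ $$\mathbb F_{abc}(t)=\mathbf 1_{\{\lambda_c\le t\le\lambda_a\}}\int_{\Phi_b(\lambda_c)}^{\Phi_b(t)}\mathcal I_{ab}(F_a,f_b)\,\mathcal I_{bc}(f_b,F_c)\,df_b,\qquad \hat\alpha_{abc}=1-\frac{\mathbb F_{abc}(\lambda_b)}{\mathbb F_{abc}(\lambda_a)}.$$ Theorem. Let $0\le a<b<c\le K+1$ and let $\hat m$ satisfy the stopping-time condition. (i) Conditional on the event that $\hat m=a$, that $X\beta^0\in H_a$, and that $(\hat\imath_1,\dots,\hat\imath_K)$ satisfies the Irrepresentable Check, provided that this event has positive probability, $\hat\alpha_{abc}$ is uniformly distributed on $(0,1)$. (ii) The same holds conditional on $\{\hat m=a,\hat\imath_1=i_1,\dots,\hat\imath_K=i_K\}$, provided that this event has positive probability, for every fixed sequence $i_1=(j_1,s_1),\dots,i_K=(j_K,s_K)$ that satisfies the Irrepresentable Check and is such that $X\beta^0\in\mathrm{Span}(X_{j_1},\dots,X_{j_a})$. -/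

import Mathlib

open MeasureTheory ProbabilityTheory Matrix

noncomputable section

namespace LAR

/-- Signed variables: a variable `j ∈ [p]` with a sign `s ∈ {1, -1}`
(the pair encoded by the integer `j + p (1 - s) / 2 ∈ [2p]`). -/
abbrev SignedVar (p : ℕ) := Fin p × ℤˣ

/-- The sign as a real number. -/
def sgn {p : ℕ} (i : SignedVar p) : ℝ := ((i.2 : ℤ) : ℝ)

variable {n p : ℕ}

/-! Sequences `i₁, i₂, …` of signed variables are functions `i : ℕ → SignedVar p` with `i k` the
`k`-th entry for `k ≥ 1`; the value `i 0` is never used. -/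

/-- The `j`-th column `X_j` of the design. -/
def col (X : Matrix (Fin n) (Fin p) ℝ) (j : Fin p) : EuclideanSpace ℝ (Fin n) :=
  WithLp.toLp 2 (fun l => X l j)

/-- `H_k(i) = Span(X_{j_1}, …, X_{j_k})`. -/
def colSpan (X : Matrix (Fin n) (Fin p) ℝ) (i : ℕ → SignedVar p) (k : ℕ) :
    Submodule ℝ (EuclideanSpace ℝ (Fin n)) :=
  Submodule.span ℝ ((fun l => col X (i l).1) '' Set.Icc 1 k)

/-- The Gram matrix `X_{T^k}ᵀ X_{T^k}` of the columns `j_1, …, j_k`. -/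
def gram (X : Matrix (Fin n) (Fin p) ℝ) (i : ℕ → SignedVar p) (k : ℕ) :
    Matrix (Fin k) (Fin k) ℝ :=
  Matrix.of fun l m => (Xᵀ * X) (i (l + 1)).1 (i (m + 1)).1

/-- `X_jᵀ X_{T^k} (X_{T^k}ᵀ X_{T^k})⁻¹ (s_1, …, s_k)`. -/
def thetaBar (X : Matrix (Fin n) (Fin p) ℝ) (i : ℕ → SignedVar p) (k : ℕ) (j : Fin p) : ℝ :=
  (fun l : Fin k => (Xᵀ * X) j (i (l + 1)).1) ⬝ᵥ
    ((gram X i k)⁻¹ *ᵥ fun l : Fin k => sgn (i (l + 1)))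

/-- Irrepresentable Check for `(i_1, …, i_K)`: the variables `j_1, …, j_K` are pairwise different
and, for `k ∈ [K]`, the inverse Gram matrix exists and every signed variable `(j, ±1)` with
`j ∉ {j_1, …, j_k}` satisfies `± X_jᵀ X_{T^k} (X_{T^k}ᵀ X_{T^k})⁻¹ s_k < 1`. -/
def IrrCheck (X : Matrix (Fin n) (Fin p) ℝ) (i : ℕ → SignedVar p) (K : ℕ) : Prop :=
  Set.InjOn (fun l => (i l).1) (Set.Icc 1 K) ∧
  ∀ k ∈ Set.Icc 1 K, IsUnit (gram X i k).det ∧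
    ∀ j : Fin p, (∀ l ∈ Set.Icc 1 k, (i l).1 ≠ j) → |thetaBar X i k j| < 1

/-! ### The least angle regression path -/

/-- A maximizer of `f` over `s` (the smallest index in case of ties). -/
def argmaxOn [NeZero p] (s : Finset (Fin p)) (f : Fin p → ℝ) : Fin p :=
  if h : (s.filter fun j => ∀ l ∈ s, f l ≤ f j).Nonempty then
    (s.filter fun j => ∀ l ∈ s, f l ≤ f j).min' h
  else 0

/-- The sign of a nonzero real number. -/
def signOf (x : ℝ) : ℤˣ := if 0 ≤ x then 1 else -1

/-- State of the algorithm after `k` steps: the signed variables entered so far (the values of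
`idx` at `1, …, k`), the current knot `λ_k` and the current residual correlations `N^{(k)}`. -/
structure State (p : ℕ) where
  idx : ℕ → SignedVar p
  knot : ℝ
  resid : Fin p → ℝ

/-- First step: `λ_1 = max |Xᵀ y|`, attained at `j_1` with sign `ε_1`, and `N^{(1)} = Xᵀ y`. -/
def firstStep [NeZero p] (X : Matrix (Fin n) (Fin p) ℝ) (y : EuclideanSpace ℝ (Fin n)) : State p :=
  let Z : Fin p → ℝ := Xᵀ *ᵥ (WithLp.ofLp y)
  let j := argmaxOn Finset.univ fun j => |Z j|
  ⟨fun _ => (j, signOf (Z j)), |Z j|, Z⟩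

/-- Residual correlations `N(β) = N^{(k)} - (λ_k - β) θ` for `0 < β ≤ λ_k`, where `k` variables
have entered. -/
def residAt (X : Matrix (Fin n) (Fin p) ℝ) (k : ℕ) (S : State p) (β : ℝ) (j : Fin p) : ℝ :=
  S.resid j - (S.knot - β) * thetaBar X S.idx k j

/-- The variables that are not among the first `k`. -/
def inactive (k : ℕ) (S : State p) : Finset (Fin p) :=
  Finset.univ \ (Finset.Icc 1 k).image fun l => (S.idx l).1

/-- The step from `k` to `k + 1` variables: the next knot is the largest `β ∈ (0, λ_k]` at which
the absolute residual correlation of an inactive variable reaches `β`. -/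
def nextStep [NeZero p] (X : Matrix (Fin n) (Fin p) ℝ) (k : ℕ) (S : State p) : State p :=
  let lam : ℝ := sSup {β : ℝ | 0 < β ∧ β ≤ S.knot ∧ ∃ j ∈ inactive k S, |residAt X k S β j| = β}
  let j := argmaxOn (inactive k S) fun j => |residAt X k S lam j|
  ⟨Function.update S.idx (k + 1) (j, signOf (residAt X k S lam j)), lam, residAt X k S lam⟩

/-- `state X y k` is the state after `k + 1` variables have entered. -/
def state [NeZero p] (X : Matrix (Fin n) (Fin p) ℝ) (y : EuclideanSpace ℝ (Fin n)) : ℕ → State p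
  | 0 => firstStep X y
  | k + 1 => nextStep X (k + 1) (state X y k)

/-- The knots `λ_k`, `k ≥ 1`. -/
def knot [NeZero p] (X : Matrix (Fin n) (Fin p) ℝ) (y : EuclideanSpace ℝ (Fin n)) (k : ℕ) : ℝ :=
  (state X y (k - 1)).knot

/-- The knots with the convention `λ_0 = ∞`. -/
def knotE [NeZero p] (X : Matrix (Fin n) (Fin p) ℝ) (y : EuclideanSpace ℝ (Fin n)) : ℕ → EReal
  | 0 => ⊤
  | k + 1 => (knot X y (k + 1) : ℝ)

/-- The signed variables `î_k`, `k ≥ 1`, entering along the path. -/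
def index [NeZero p] (X : Matrix (Fin n) (Fin p) ℝ) (y : EuclideanSpace ℝ (Fin n)) (k : ℕ) :
    SignedVar p :=
  (state X y (k - 1)).idx k

/-! ### Variance parameters of the knots -/

/-- The matrix `R = [[XᵀX, -XᵀX], [-XᵀX, XᵀX]]`. -/
def R (X : Matrix (Fin n) (Fin p) ℝ) (i j : SignedVar p) : ℝ :=
  sgn i * sgn j * (Xᵀ * X) i.1 j.1

/-- `M_{i_1, …, i_k}`, the submatrix of `R` on `i_1, …, i_k`. -/
def M (X : Matrix (Fin n) (Fin p) ℝ) (i : ℕ → SignedVar p) (k : ℕ) : Matrix (Fin k) (Fin k) ℝ :=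
  Matrix.of fun l m => R X (i (l + 1)) (i (m + 1))

/-- The row `(R_{j,i_1}, …, R_{j,i_k})`. -/
def row (X : Matrix (Fin n) (Fin p) ℝ) (i : ℕ → SignedVar p) (k : ℕ) (j : SignedVar p) :
    Fin k → ℝ :=
  fun l => R X j (i (l + 1))

/-- `θ_j(i_1, …, i_k)`. -/
def theta (X : Matrix (Fin n) (Fin p) ℝ) (i : ℕ → SignedVar p) (k : ℕ) (j : SignedVar p) : ℝ :=
  row X i k j ⬝ᵥ ((M X i k)⁻¹ *ᵥ fun _ => 1)

/-- `ρ_k`. The value at `0` is never relevant, since `λ_0 = ∞`. -/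
def rho (X : Matrix (Fin n) (Fin p) ℝ) (i : ℕ → SignedVar p) : ℕ → ℝ
  | 0 => 1
  | k + 1 =>
    √(R X (i (k + 1)) (i (k + 1)) -
        row X i k (i (k + 1)) ⬝ᵥ ((M X i k)⁻¹ *ᵥ row X i k (i (k + 1)))) /
      (1 - theta X i k (i (k + 1)))

/-! ### The variance estimate used for selection, and selection rules -/

/-- `V_ℓ = Span(e_1, …, e_ℓ)`. -/
def V (n ℓ : ℕ) : Submodule ℝ (EuclideanSpace ℝ (Fin n)) :=
  Submodule.span ℝ ((fun l : Fin n => EuclideanSpace.single l (1 : ℝ)) '' {l | (l : ℕ) < ℓ})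

/-- The projection of `V_ℓ` on the orthogonal of `X_{j_1}, …, X_{j_k}`. -/
def projV (X : Matrix (Fin n) (Fin p) ℝ) (i : ℕ → SignedVar p) (k ℓ : ℕ) :
    Submodule ℝ (EuclideanSpace ℝ (Fin n)) :=
  (V n ℓ).map (((colSpan X i k)ᗮ.starProjection :
    EuclideanSpace ℝ (Fin n) →L[ℝ] EuclideanSpace ℝ (Fin n)) :
    EuclideanSpace ℝ (Fin n) →ₗ[ℝ] EuclideanSpace ℝ (Fin n))

/-- The space `E_1 = P^⊥_k(V_ℓ)`, with `ℓ` such that its dimension is `n₁`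
(all such `ℓ` give the same space). -/
def E1 (X : Matrix (Fin n) (Fin p) ℝ) (i : ℕ → SignedVar p) (k n₁ : ℕ) :
    Submodule ℝ (EuclideanSpace ℝ (Fin n)) :=
  projV X i k (sInf {ℓ : ℕ | Module.finrank ℝ (projV X i k ℓ) = n₁})

/-- `σ̂_select = ‖P_{E_1} y‖ / √n₁`, built from the first `K + 1` variables of the path. -/
def sigmaSelect [NeZero p] (X : Matrix (Fin n) (Fin p) ℝ) (K n₁ : ℕ)
    (y : EuclideanSpace ℝ (Fin n)) : ℝ :=
  ‖(E1 X (index X y) (K + 1) n₁).starProjection y‖ / √n₁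

/-- Stopping rule: `m̂ ∈ {0, …, K - 1}` and, for every `a ≤ K - 1`, the indicator of `{m̂ ≤ a}` is a
measurable function of `(λ_1, …, λ_a, î_1, …, î_{K+1}, σ̂_select)`. As `(î_1, …, î_{K+1})` takes
finitely many values, this is a measurable set of `(λ_1, …, λ_a, σ̂_select)` for each of them. -/
def StoppingRule [NeZero p] {Ω : Type*} (X : Matrix (Fin n) (Fin p) ℝ) (K n₁ : ℕ)
    (Y : Ω → EuclideanSpace ℝ (Fin n)) (m : Ω → ℕ) : Prop :=
  (∀ ω, m ω < K) ∧
  ∀ a < K, ∃ B : (Fin (K + 1) → SignedVar p) → Set ((Fin a → ℝ) × ℝ),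
    (∀ i, MeasurableSet (B i)) ∧
    ∀ ω, m ω ≤ a ↔
      ((fun k : Fin a => knot X (Y ω) (k + 1)), sigmaSelect X K n₁ (Y ω)) ∈
        B (fun k : Fin (K + 1) => index X (Y ω) (k + 1))

/-! ### The function `F_abc` and the p-value. Here `v k = σ ρ_k` and `lam k = λ_k`. -/

/-- The CDF of the centered Gaussian law with standard deviation `v`, on the extended line. -/
def Phi (v : ℝ) (x : EReal) : ℝ :=
  (gaussianReal 0 (Real.toNNReal (v ^ 2))).real {y : ℝ | (y : EReal) ≤ x}

/-- The inverse (quantile function) of `Phi v`; it takes the value `∞` at `1`. -/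
def PhiInv (v : ℝ) (u : ℝ) : EReal := sInf {x : EReal | u ≤ Phi v x}

/-- `P_{i,j} = Φ_i ∘ Φ_j⁻¹`. -/
def Ptr (v : ℕ → ℝ) (i j : ℕ) (u : ℝ) : ℝ := Phi (v i) (PhiInv (v j) u)

/-- The iterated integral
`∫_{P_{a+1,b}(t)}^{P_{a+1,a}(s)} df_{a+1} ∫_{P_{a+2,b}(t)}^{P_{a+2,a+1}(f_{a+1})} df_{a+2} ⋯`
over `d` variables `f_{a+1}, …, f_{a+d}`. -/
def iterInt (v : ℕ → ℝ) (b : ℕ) (t : ℝ) : ℕ → ℕ → ℝ → ℝ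
  | 0, _, _ => 1
  | d + 1, a, s => ∫ f in (Ptr v (a + 1) b t)..(Ptr v (a + 1) a s), iterInt v b t d (a + 1) f

/-- `I_ab(s, t)`, with variables `f_{a+1}, …, f_{b-1}`. -/
def Iab (v : ℕ → ℝ) (a b : ℕ) (s t : ℝ) : ℝ := iterInt v b t (b - a - 1) a s

open Classical in
/-- `F_abc(t)`. -/
def Fabc (v : ℕ → ℝ) (lam : ℕ → EReal) (a b c : ℕ) (t : EReal) : ℝ :=
  if lam c ≤ t ∧ t ≤ lam a then
    ∫ f in (Phi (v b) (lam c))..(Phi (v b) t),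
      Iab v a b (Phi (v a) (lam a)) f * Iab v b c f (Phi (v c) (lam c))
  else 0

/-- The p-value `α̂_abc = 1 - F_abc(λ_b) / F_abc(λ_a)`, as a function of the observation `y`. -/
def alphaHat [NeZero p] (X : Matrix (Fin n) (Fin p) ℝ) (σ : ℝ) (a b c : ℕ)
    (y : EuclideanSpace ℝ (Fin n)) : ℝ :=
  let v : ℕ → ℝ := fun k => σ * rho X (index X y) k
  1 - Fabc v (knotE X y) a b c (knotE X y b) / Fabc v (knotE X y) a b c (knotE X y a)

end LAR

end

/-!
Fix a sequence `i` of signed variables that satisfies the Irrepresentable Check. Along this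
sequence the path is explicit. Projecting the `k`-th column off the preceding ones and rescaling
gives a vector `knotDir X i k` such that, as long as the path follows the sequence, the `k`-th knot
is the linear form `L k = ⟪knotDir X i k, y⟫`. This is because the residual correlations, as
functions of the level, pass continuously from one active set to the next
(`corr_add_thetaBar_succ`), and because `|θ| < 1` makes each line of residual correlations cross the
diagonal at exactly one level (`hit`). The same crossing property shows that the path follows the
sequence for `K` steps if and only if `L 1 ≥ L 2 ≥ ⋯ ≥ L K ≥ Λ`, up to ties: here `Λ` is the knot
number `K + 1`, a function of the projection `W` of `y` off the first `K` columns
(`knot_eq_pathVec`, `index_eq_of_pathVec`). Ties and `Λ = 0` have probability zero (`ae_pathVec`).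

The vectors `knotDir X i k` are pairwise orthogonal and lie in the span of the first `K` columns.
So `L 1, …, L K` and `W` are independent (`map_inner_prod_starProjection`), and `L k` has standard
deviation `σ ρ k` (`rho_eq_norm`). If the mean of the observation lies in the span of the first `a`
columns, then `L k` is centered for `k > a`. The next signed variable and the variance estimate are
functions of `W`, hence on the selection event `{m̂ = a}` is an event about `L 1, …, L a` and `W`
(`StoppingRule.exists_set`).

Consequently, conditionally on everything except the knots strictly between `a` and `c`, these knots
are independent centered Gaussian variables conditioned to be nonincreasing together with the given
values at `a` and `c`. Integrating out all of them but `L b` leaves for `L b` the density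
`chainVol a b * chainVol b c` with respect to its Gaussian law. The substitutions
`f_k = Φ_k(ℓ_k)` turn the iterated integrals defining `F_abc` into the mass that this density gives
to a half-line (`Fabc_eq_bridge`). So the p-value is the conditional upper tail of `L b`, evaluated
at `L b` itself (`alphaHat_eq_tailProb`), and is uniform by the probability integral transform
(`map_cdf_eq_uniform`, `lmarginal_tailProb`). This gives the law of the p-value on the event of a
fixed sequence (`map_alphaHat_restrict`). The event of the first claim is a finite disjoint union of
such events.
-/

noncomputable section

open scoped ENNReal RealInnerProductSpace

namespace LAR

/-! ### The probability integral transform -/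

lemma continuous_cdf_of_nullSingletonClass (μ : Measure ℝ) [IsProbabilityMeasure μ]
    [NullSingletonClass μ] : Continuous (cdf μ) := by
  rw [continuous_iff_continuousAt]
  intro x
  rw [(monotone_cdf μ).continuousAt_iff_leftLim_eq_rightLim, (cdf μ).rightLim_eq]
  have h : (cdf μ).measure {x} = 0 := by rw [measure_cdf]; simp
  rw [StieltjesFunction.measure_singleton, ENNReal.ofReal_eq_zero] at h
  exact le_antisymm ((monotone_cdf μ).leftLim_le le_rfl) (by linarith)

/-- Probability integral transform: the distribution function of an atomless law, evaluated at a
variable with that law, is uniformly distributed. -/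
lemma map_cdf_eq_uniform (μ : Measure ℝ) [IsProbabilityMeasure μ] [NullSingletonClass μ] :
    μ.map (cdf μ) = volume.restrict (Set.Ioo (0 : ℝ) 1) := by
  have hc := continuous_cdf_of_nullSingletonClass μ
  have hm : Measurable (cdf μ) := hc.measurable
  have : IsProbabilityMeasure (μ.map (cdf μ)) := Measure.isProbabilityMeasure_map hm.aemeasurable
  refine Measure.ext_of_Iic _ _ fun u => ?_
  rw [Measure.map_apply hm measurableSet_Iic, Measure.restrict_apply measurableSet_Iic]
  rcases lt_or_ge u 0 with hu | hu
  · have h1 : cdf μ ⁻¹' Set.Iic u = ∅ := by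
      ext z; simp only [Set.mem_preimage, Set.mem_Iic, Set.mem_empty_iff_false, iff_false, not_le]
      exact hu.trans_le (cdf_nonneg μ z)
    have h2 : Set.Iic u ∩ Set.Ioo (0 : ℝ) 1 = ∅ := by
      ext z; simp only [Set.mem_inter_iff, Set.mem_Iic, Set.mem_Ioo, Set.mem_empty_iff_false,
        iff_false]; rintro ⟨h, h', -⟩; linarith
    rw [h1, h2]; simp
  rcases le_or_gt 1 u with hu1 | hu1
  · have h1 : cdf μ ⁻¹' Set.Iic u = Set.univ := by
      ext z; simp only [Set.mem_preimage, Set.mem_Iic, Set.mem_univ, iff_true]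
      exact (cdf_le_one μ z).trans hu1
    have h2 : Set.Iic u ∩ Set.Ioo (0 : ℝ) 1 = Set.Ioo 0 1 :=
      Set.inter_eq_right.2 fun z hz => hz.2.le.trans hu1
    rw [h1, h2]; simp
  have h2 : Set.Iic u ∩ Set.Ioo (0 : ℝ) 1 = Set.Ioc 0 u := by
    ext z; simp only [Set.mem_inter_iff, Set.mem_Iic, Set.mem_Ioo, Set.mem_Ioc]
    constructor
    · rintro ⟨h, h', -⟩; exact ⟨h', h⟩
    · rintro ⟨h, h'⟩; exact ⟨h', h, h'.trans_lt hu1⟩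
  rw [h2, Real.volume_Ioc, sub_zero]
  apply le_antisymm
  · rcases (cdf μ ⁻¹' Set.Iic u).eq_empty_or_nonempty with he | hne
    · rw [he]; simp
    -- the sublevel set is a closed half-line, bounded since the distribution function tends to 1
    have hbdd : BddAbove (cdf μ ⁻¹' Set.Iic u) := by
      obtain ⟨b, hb⟩ := ((tendsto_cdf_atTop μ).eventually_const_lt hu1).exists
      refine ⟨b, fun z hz => ?_⟩
      by_contra hlt
      exact absurd ((monotone_cdf μ) (not_le.1 hlt).le) (not_le.2 (lt_of_le_of_lt hz hb))
    have hcl : IsClosed (cdf μ ⁻¹' Set.Iic u) := isClosed_Iic.preimage hc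
    have hmem := hcl.csSup_mem hne hbdd
    calc μ (cdf μ ⁻¹' Set.Iic u) ≤ μ (Set.Iic (sSup (cdf μ ⁻¹' Set.Iic u))) :=
          measure_mono fun z hz => le_csSup hbdd hz
      _ = ENNReal.ofReal (cdf μ (sSup (cdf μ ⁻¹' Set.Iic u))) := (ofReal_cdf μ _).symm
      _ ≤ ENNReal.ofReal u := ENNReal.ofReal_le_ofReal hmem
  · rcases hu.eq_or_lt with h0 | h0
    · rw [← h0]; simp
    have hz : ∃ z, cdf μ z = u := by
      obtain ⟨b, hb⟩ := ((tendsto_cdf_atTop μ).eventually_const_lt hu1).exists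
      obtain ⟨d, hd⟩ := ((tendsto_cdf_atBot μ).eventually_lt_const h0).exists
      exact mem_range_of_exists_le_of_exists_ge hc ⟨d, hd.le⟩ ⟨b, hb.le⟩
    obtain ⟨z, rfl⟩ := hz
    rw [ofReal_cdf]
    exact measure_mono fun y hy => (monotone_cdf μ) hy

lemma map_one_sub_uniform :
    (volume.restrict (Set.Ioo (0 : ℝ) 1)).map (fun u => 1 - u) =
      volume.restrict (Set.Ioo (0 : ℝ) 1) := by
  have h := (Measure.measurePreserving_sub_left (volume : Measure ℝ) 1).restrict_preimage
    (measurableSet_Ioo (a := (0 : ℝ)) (b := 1))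
  have h' : (fun u : ℝ => 1 - u) ⁻¹' Set.Ioo 0 1 = Set.Ioo 0 1 := by
    ext u; simp only [Set.mem_preimage, Set.mem_Ioo]; constructor <;> rintro ⟨h, h'⟩ <;>
      constructor <;> linarith
  rw [h'] at h
  exact h.map_eq

/-- The upper tail function of a finite atomless measure, normalized by the total mass and evaluated
at a variable distributed according to that measure, is uniform. -/
lemma lintegral_indicator_tail (ν : Measure ℝ) [IsFiniteMeasure ν] [NullSingletonClass ν]
    {B : Set ℝ} (hB : MeasurableSet B) :
    ∫⁻ z, B.indicator 1 (1 - (ν (Set.Iic z) / ν Set.univ).toReal) ∂ν =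
      volume.restrict (Set.Ioo (0 : ℝ) 1) B * ν Set.univ := by
  by_cases h0 : ν = 0
  · simp [h0]
  have hu0 : ν Set.univ ≠ 0 := by simpa using h0
  have hut : ν Set.univ ≠ ∞ := measure_ne_top _ _
  set μ : Measure ℝ := (ν Set.univ)⁻¹ • ν with hμ
  have : IsProbabilityMeasure μ := ⟨by simp [hμ, ENNReal.inv_mul_cancel hu0 hut]⟩
  have : NullSingletonClass μ := ⟨fun x => by simp [hμ]⟩
  have hν : ν = ν Set.univ • μ := by
    rw [hμ, smul_smul, ENNReal.mul_inv_cancel hu0 hut, one_smul]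
  have hF : ∀ z, (ν (Set.Iic z) / ν Set.univ).toReal = cdf μ z := fun z => by
    rw [cdf_eq_real, measureReal_def, hμ, Measure.smul_apply, smul_eq_mul, ENNReal.div_eq_inv_mul]
  simp_rw [hF]
  have hm : Measurable (cdf μ) := (continuous_cdf_of_nullSingletonClass μ).measurable
  have hi : Measurable (B.indicator (1 : ℝ → ℝ≥0∞)) := measurable_one.indicator hB
  calc ∫⁻ z, B.indicator 1 (1 - cdf μ z) ∂ν
      = ν Set.univ * ∫⁻ z, B.indicator 1 (1 - cdf μ z) ∂μ := by
        conv_lhs => rw [hν]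
        rw [lintegral_smul_measure, smul_eq_mul]
    _ = ν Set.univ * ∫⁻ u, B.indicator 1 (1 - u) ∂(μ.map (cdf μ)) := by
        rw [lintegral_map (f := fun u => B.indicator 1 (1 - u)) (hi.comp (by fun_prop)) hm]
    _ = ν Set.univ * ∫⁻ u, B.indicator 1 u ∂(volume.restrict (Set.Ioo (0 : ℝ) 1)) := by
        rw [map_cdf_eq_uniform]
        conv_rhs => rw [← map_one_sub_uniform]
        rw [lintegral_map hi (by fun_prop)]
    _ = _ := by rw [lintegral_indicator_one hB, mul_comm]

/-! ### Gaussian distribution functions -/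

/-- The centered Gaussian law with standard deviation `v`. -/
abbrev gauss (v : ℝ) : Measure ℝ := gaussianReal 0 (Real.toNNReal (v ^ 2))

lemma nullSingletonClass_gauss {v : ℝ} (hv : 0 < v) : NullSingletonClass (gauss v) :=
  nullSingletonClass_gaussianReal (by simpa using hv.ne')

lemma Phi_mono (v : ℝ) : Monotone (Phi v) := fun _ _ h =>
  measureReal_mono (fun _ hz => le_trans hz h)

lemma Phi_coe (v x : ℝ) : Phi v x = cdf (gauss v) x := by
  rw [cdf_eq_real, Phi]
  congr 1
  ext z; simp

lemma Phi_strictMono {v : ℝ} (hv : 0 < v) : StrictMono (Phi v) := by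
  intro x y hxy
  obtain ⟨q, hxq, hqy⟩ := EReal.lt_iff_exists_real_btwn.1 hxy
  obtain ⟨r, hqr, hry⟩ := EReal.lt_iff_exists_real_btwn.1 hqy
  have hne : Real.toNNReal (v ^ 2) ≠ 0 := by simpa using hv.ne'
  have hpos : 0 < (gauss v).real (Set.Ioc q r) := by
    have : (gauss v) (Set.Ioc q r) ≠ 0 := by
      intro h0
      have := (gaussianReal_absolutelyContinuous' 0 hne) h0
      rw [Real.volume_Ioc, ENNReal.ofReal_eq_zero] at this
      have : q < r := by exact_mod_cast hqr
      linarith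
    exact ENNReal.toReal_pos this (measure_ne_top _ _)
  have hd : Disjoint {z : ℝ | (z : EReal) ≤ x} (Set.Ioc q r) := by
    rw [Set.disjoint_left]
    intro z hz hz'
    have : (q : EReal) < z := by exact_mod_cast hz'.1
    exact absurd (hz : (z : EReal) ≤ x) (not_le.2 (hxq.trans this))
  have hu := measureReal_union (μ := gauss v) hd measurableSet_Ioc
  have hle : (gauss v).real ({z : ℝ | (z : EReal) ≤ x} ∪ Set.Ioc q r) ≤ Phi v y := by
    refine measureReal_mono ?_
    rintro z (hz | hz)
    · exact le_trans hz hxy.le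
    · exact le_trans (by exact_mod_cast hz.2) hry.le
  change (gauss v).real _ < _
  linarith

/-- This includes the infinite arguments, since `PhiInv` takes values in the extended line. -/
lemma PhiInv_Phi {v : ℝ} (hv : 0 < v) (x : EReal) : PhiInv v (Phi v x) = x := by
  unfold PhiInv
  simp_rw [(Phi_strictMono hv).le_iff_le]
  exact (isLeast_Ici (a := x)).csInf_eq

lemma Ptr_Phi {v : ℕ → ℝ} {j : ℕ} (hv : 0 < v j) (i : ℕ) (x : EReal) :
    Ptr v i j (Phi (v j) x) = Phi (v i) x := by
  rw [Ptr, PhiInv_Phi hv]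

lemma map_Phi_gauss {v : ℝ} (hv : 0 < v) :
    (gauss v).map (fun z : ℝ => Phi v z) = volume.restrict (Set.Ioo (0 : ℝ) 1) := by
  have := nullSingletonClass_gauss hv
  simp_rw [Phi_coe]
  exact map_cdf_eq_uniform _

/-- Change of variables `f = Φ(z)` in an integral between two values of `Φ`. -/
lemma integral_Phi_Phi {v : ℝ} (hv : 0 < v) {l u : EReal} (h : l ≤ u) (g : ℝ → ℝ) :
    ∫ f in (Phi v l)..(Phi v u), g f =
      ∫ z in {z : ℝ | l < (z : EReal) ∧ (z : EReal) ≤ u}, g (Phi v z) ∂gauss v := by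
  have hmono : StrictMono (fun z : ℝ => Phi v z) := fun x y hxy =>
    Phi_strictMono hv (by exact_mod_cast hxy)
  have hemb : MeasurableEmbedding (fun z : ℝ => Phi v z) :=
    hmono.monotone.measurable.measurableEmbedding hmono.injective
  have h0 : 0 ≤ Phi v l := measureReal_nonneg
  have h1 : Phi v u ≤ 1 := measureReal_le_one
  rw [intervalIntegral.integral_of_le (Phi_mono v h)]
  have hset : (volume : Measure ℝ).restrict (Set.Ioc (Phi v l) (Phi v u)) =
      ((volume : Measure ℝ).restrict (Set.Ioo 0 1)).restrict (Set.Ioc (Phi v l) (Phi v u)) := by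
    rw [Measure.restrict_congr_set (Ioo_ae_eq_Ioc (μ := volume) (a := (0 : ℝ)) (b := 1)),
      Measure.restrict_restrict measurableSet_Ioc, Set.inter_eq_left.2]
    exact Set.Ioc_subset_Ioc h0 h1
  rw [hset, ← map_Phi_gauss hv, hemb.restrict_map, hemb.integral_map]
  congr 2
  ext z
  simp only [Set.mem_preimage, Set.mem_Ioc, Set.mem_ofPred_eq, (Phi_strictMono hv).lt_iff_lt,
    (Phi_strictMono hv).le_iff_le]

/-! ### Decreasing sequences of independent variables -/

lemma dependsOn_lmarginal {s : Finset ℕ} {t : Set ℕ} (γ : ℕ → Measure ℝ)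
    {f : (ℕ → ℝ) → ℝ≥0∞} (hf : DependsOn f t) : DependsOn (∫⋯∫⁻_s, f ∂γ) (t \ s) := by
  intro x y hxy
  unfold lmarginal
  congr 1
  ext w
  refine hf fun i hi => ?_
  by_cases his : i ∈ s
  · simp [Function.updateFinset, his]
  · simp [Function.updateFinset, his, hxy i ⟨hi, by simpa using his⟩]

lemma lmarginal_mul_of_dependsOn {s : Finset ℕ} (γ : ℕ → Measure ℝ)
    [∀ k, IsProbabilityMeasure (γ k)] {f g : (ℕ → ℝ) → ℝ≥0∞} (hf : DependsOn f (s : Set ℕ)ᶜ)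
    (hg : Measurable g) (x : ℕ → ℝ) :
    (∫⋯∫⁻_s, (fun x => f x * g x) ∂γ) x = f x * (∫⋯∫⁻_s, g ∂γ) x := by
  unfold lmarginal
  have h : Measurable fun w : (i : s) → ℝ => g (Function.updateFinset x s w) :=
    hg.comp measurable_updateFinset
  rw [← lintegral_const_mul _ h]
  refine lintegral_congr fun w => ?_
  refine congrArg (· * _) ?_
  refine hf fun i hi => ?_
  have : i ∉ s := by simpa using hi
  simp [Function.updateFinset, this]

/-- The sequence `x 1, x 2, …` on the extended line, with the value `∞` in place of `x 0`, in
accordance with the convention `λ₀ = ∞`. -/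
def knotSeq (x : ℕ → ℝ) : ℕ → EReal
  | 0 => ⊤
  | k + 1 => (x (k + 1) : ℝ)

lemma measurable_knotSeq (k : ℕ) : Measurable fun x => knotSeq x k := by
  cases k with
  | zero => exact measurable_const
  | succ k => exact measurable_coe_real_ereal.comp (measurable_pi_apply _)

lemma knotSeq_congr {x y : ℕ → ℝ} {k : ℕ} (h : x k = y k) : knotSeq x k = knotSeq y k := by
  cases k <;> simp_all [knotSeq]

lemma knotSeq_of_pos {x : ℕ → ℝ} {k : ℕ} (h : 0 < k) : knotSeq x k = x k := by
  cases k
  · omega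
  · rfl

/-- The sequences that do not increase between the indices `a` and `b`; at `a = 0` there is no
constraint on the first entry, by the convention built into `knotSeq`. -/
def decr (a b : ℕ) : Set (ℕ → ℝ) :=
  {x | ∀ k ∈ Set.Ico a b, knotSeq x (k + 1) ≤ knotSeq x k}

lemma measurableSet_decr (a b : ℕ) : MeasurableSet (decr a b) := by
  have : decr a b = ⋂ k ∈ Set.Ico a b, {x | knotSeq x (k + 1) ≤ knotSeq x k} := by
    ext x; simp [decr]
  rw [this]
  exact MeasurableSet.biInter (Set.to_countable _) fun k _ =>
    measurableSet_le (measurable_knotSeq _) (measurable_knotSeq _)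

lemma decr_le {a b : ℕ} (hab : a ≤ b) {x : ℕ → ℝ} (hx : x ∈ decr a b) :
    knotSeq x b ≤ knotSeq x a := by
  induction b, hab using Nat.le_induction with
  | base => exact le_rfl
  | succ b hb ih =>
    exact (hx b ⟨hb, Nat.lt_succ_self b⟩).trans
      (ih fun k hk => hx k ⟨hk.1, hk.2.trans (Nat.lt_succ_self b)⟩)

/-- The indicator of `decr a b`. -/
def decrInd (a b : ℕ) : (ℕ → ℝ) → ℝ≥0∞ := (decr a b).indicator 1

lemma measurable_decrInd (a b : ℕ) : Measurable (decrInd a b) :=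
  measurable_one.indicator (measurableSet_decr a b)

lemma decrInd_le_one (a b : ℕ) (x : ℕ → ℝ) : decrInd a b x ≤ 1 :=
  Set.indicator_le_self' (by simp) x

lemma decrInd_mul {a b c : ℕ} (hab : a ≤ b) (hbc : b ≤ c) (x : ℕ → ℝ) :
    decrInd a c x = decrInd a b x * decrInd b c x := by
  have h : decr a c = decr a b ∩ decr b c := by
    ext x
    simp only [decr, Set.mem_Ico, Set.mem_inter_iff, Set.mem_ofPred_eq]
    constructor
    · exact fun h => ⟨fun k hk => h k ⟨hk.1, by omega⟩, fun k hk => h k ⟨by omega, hk.2⟩⟩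
    · rintro ⟨h, h'⟩ k hk
      rcases lt_or_ge k b with hkb | hkb
      · exact h k ⟨hk.1, hkb⟩
      · exact h' k ⟨hkb, hk.2⟩
  rw [decrInd, h, Set.inter_indicator_one]
  rfl

lemma dependsOn_decrInd (a b : ℕ) : DependsOn (decrInd a b) (Set.Icc a b) := by
  intro x y hxy
  have h : x ∈ decr a b ↔ y ∈ decr a b := by
    refine forall₂_congr fun k hk => ?_
    rw [knotSeq_congr (hxy (k + 1) ⟨by have := hk.1; omega, hk.2⟩),
      knotSeq_congr (hxy k ⟨hk.1, hk.2.le⟩)]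
  by_cases hx : x ∈ decr a b
  · simp [decrInd, hx, h.1 hx]
  · simp [decrInd, hx, mt h.2 hx]

section Chain

variable (γ : ℕ → Measure ℝ)

/-- The probability that independent variables `x k` with laws `γ k`, `a < k < b`, form a
nonincreasing sequence together with the given values at `a` and `b`. -/
def chainVol (a b : ℕ) : (ℕ → ℝ) → ℝ≥0∞ := ∫⋯∫⁻_Finset.Ioo a b, decrInd a b ∂γ

lemma dependsOn_chainVol {a b : ℕ} (hab : a < b) : DependsOn (chainVol γ a b) {a, b} := by
  have h := dependsOn_lmarginal (s := Finset.Ioo a b) γ (dependsOn_decrInd a b)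
  have hs : Set.Icc a b \ ↑(Finset.Ioo a b) = ({a, b} : Set ℕ) := by
    ext k; simp only [Finset.coe_Ioo, Set.mem_sdiff, Set.mem_Icc, Set.mem_Ioo,
      Set.mem_insert_iff, Set.mem_singleton_iff]; omega
  rwa [hs] at h

lemma chainVol_succ (a : ℕ) : chainVol γ a (a + 1) = decrInd a (a + 1) := by
  have : Finset.Ioo a (a + 1) = ∅ := by ext k; simp
  rw [chainVol, this, lmarginal_empty]

lemma chainVol_eq_zero {a b : ℕ} (hab : a < b) {x : ℕ → ℝ} (h : ¬ knotSeq x b ≤ knotSeq x a) :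
    chainVol γ a b x = 0 := by
  unfold chainVol lmarginal
  refine lintegral_eq_zero_of_ae_eq_zero (Filter.Eventually.of_forall fun w => ?_)
  refine Set.indicator_of_notMem (fun hx => h ?_) _
  have := decr_le hab.le hx
  rwa [knotSeq_congr (y := x) (by simp [Function.updateFinset]),
    knotSeq_congr (k := a) (y := x) (by simp [Function.updateFinset])] at this

/-- The measure, in the variable at `b`, of the nonincreasing sequences with the given values of `x`
at `a` and `c`. Normalized, it is the conditional law of that variable. -/
def bridge (a b c : ℕ) (x : ℕ → ℝ) : Measure ℝ :=
  (γ b).withDensity fun z =>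
    chainVol γ a b (Function.update x b z) * chainVol γ b c (Function.update x b z)

lemma bridge_apply (a b c : ℕ) (x : ℕ → ℝ) {S : Set ℝ} (hS : MeasurableSet S) :
    bridge γ a b c x S = ∫⁻ z, S.indicator (fun z => chainVol γ a b (Function.update x b z) *
      chainVol γ b c (Function.update x b z)) z ∂γ b := by
  rw [bridge, withDensity_apply _ hS, lintegral_indicator hS]

lemma dependsOn_bridge {a b c : ℕ} (hab : a < b) (hbc : b < c) :
    DependsOn (bridge γ a b c) {a, c} := by
  intro x y hxy
  unfold bridge
  congr 1
  ext z
  congr 1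
  · refine dependsOn_chainVol γ hab fun k hk => ?_
    rcases hk with rfl | rfl
    · rw [Function.update_of_ne hab.ne, Function.update_of_ne hab.ne, hxy _ (by simp)]
    · simp
  · refine dependsOn_chainVol γ hbc fun k hk => ?_
    rcases hk with rfl | rfl
    · simp
    · rw [Function.update_of_ne hbc.ne', Function.update_of_ne hbc.ne', hxy _ (by simp)]

variable [∀ k, IsProbabilityMeasure (γ k)]

lemma measurable_chainVol (a b : ℕ) : Measurable (chainVol γ a b) :=
  (measurable_decrInd a b).lmarginal γ

lemma chainVol_le_one (a b : ℕ) (x : ℕ → ℝ) : chainVol γ a b x ≤ 1 := by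
  unfold chainVol lmarginal
  calc _ ≤ ∫⁻ _, 1 ∂(Measure.pi fun i : Finset.Ioo a b => γ i) :=
        lintegral_mono fun _ => decrInd_le_one _ _ _
    _ = 1 := by simp

/-- Integrating out all variables strictly between `a` and `c`, the variable `b` last. -/
lemma lmarginal_mul_decrInd {a b c : ℕ} (hab : a < b) (hbc : b < c) {φ : (ℕ → ℝ) → ℝ≥0∞}
    (hφ : Measurable φ) (hφd : DependsOn φ (Set.Ioo a b ∪ Set.Ioo b c)ᶜ) (x : ℕ → ℝ) :
    (∫⋯∫⁻_Finset.Ioo a c, (fun x => φ x * decrInd a c x) ∂γ) x =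
      ∫⁻ z, φ (Function.update x b z) * (chainVol γ a b (Function.update x b z) *
        chainVol γ b c (Function.update x b z)) ∂γ b := by
  have hs : Finset.Ioo a c = insert b (Finset.Ioo a b ∪ Finset.Ioo b c) := by
    ext k; simp only [Finset.mem_Ioo, Finset.mem_insert, Finset.mem_union]; omega
  have hd : Disjoint (Finset.Ioo a b) (Finset.Ioo b c) := by
    rw [Finset.disjoint_left]; intro k; simp only [Finset.mem_Ioo]; omega
  have hm : Measurable fun x => decrInd a c x := measurable_decrInd a c
  rw [hs, lmarginal_insert (fun x => φ x * decrInd a c x) (hφ.mul hm) (by simp)]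
  refine lintegral_congr fun z => ?_
  rw [lmarginal_mul_of_dependsOn γ (by simpa using hφd) hm]
  congr 1
  have he : decrInd a c = fun x => decrInd a b x * decrInd b c x :=
    funext fun x => decrInd_mul hab.le hbc.le x
  rw [lmarginal_union γ _ hm hd]
  have h1 : (∫⋯∫⁻_Finset.Ioo b c, (fun x => decrInd a c x) ∂γ) =
      fun x => chainVol γ b c x * decrInd a b x := by
    ext y
    rw [he, lmarginal_mul_of_dependsOn γ _ (measurable_decrInd b c), mul_comm]
    · rfl
    · refine (dependsOn_decrInd a b).mono fun k hk => ?_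
      simp only [Finset.coe_Ioo, Set.mem_compl_iff, Set.mem_Ioo, Set.mem_Icc] at hk ⊢; omega
  rw [h1, lmarginal_mul_of_dependsOn γ _ (measurable_decrInd a b), mul_comm]
  · rfl
  · refine (dependsOn_chainVol γ hbc).mono fun k hk => ?_
    simp only [Finset.coe_Ioo, Set.mem_compl_iff, Set.mem_Ioo, Set.mem_insert_iff,
      Set.mem_singleton_iff] at hk ⊢; omega

/-- The iterated integral over the distribution function values is the probability of a
nonincreasing sequence. -/
lemma iterInt_eq_chainVol {v : ℕ → ℝ} (d a : ℕ) (x : ℕ → ℝ)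
    (hv : ∀ k ∈ Set.Icc a (a + d + 1), 0 < v k)
    (hγ : ∀ k ∈ Set.Ioo a (a + d + 1), γ k = gauss (v k))
    (hx : knotSeq x (a + d + 1) ≤ knotSeq x a) :
    iterInt v (a + d + 1) (Phi (v (a + d + 1)) (knotSeq x (a + d + 1))) d a
      (Phi (v a) (knotSeq x a)) = (chainVol γ a (a + d + 1) x).toReal := by
  induction d generalizing a x with
  | zero =>
    have hmem : x ∈ decr a (a + 1) := by
      intro k hk
      obtain rfl : k = a := by have := hk.1; have := hk.2; omega
      exact hx
    rw [iterInt, add_zero, chainVol_succ]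
    simp [decrInd, hmem]
  | succ d ih =>
    set b := a + (d + 1) + 1 with hb
    have hb' : a + 1 + d + 1 = b := by omega
    have hva := hv a ⟨le_rfl, by omega⟩
    have hva1 := hv (a + 1) ⟨by omega, by omega⟩
    have hvb := hv b ⟨by omega, le_rfl⟩
    have hγ1 := hγ (a + 1) ⟨by omega, by omega⟩
    have : NullSingletonClass (γ (a + 1)) := hγ1 ▸ nullSingletonClass_gauss hva1
    have hU : ∀ z, knotSeq (Function.update x (a + 1) z) (a + 1) = z := fun z => by simp [knotSeq]
    have hUb : ∀ z, knotSeq (Function.update x (a + 1) z) b = knotSeq x b := fun z =>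
      knotSeq_congr (Function.update_of_ne (by omega) _ _)
    have hUa : ∀ z, knotSeq (Function.update x (a + 1) z) a = knotSeq x a := fun z =>
      knotSeq_congr (Function.update_of_ne (by omega) _ _)
    set S : Set ℝ := {z : ℝ | knotSeq x b < (z : EReal) ∧ (z : EReal) ≤ knotSeq x a} with hS
    have hSm : MeasurableSet S :=
      (measurableSet_lt measurable_const measurable_coe_real_ereal).inter
        (measurableSet_le measurable_coe_real_ereal measurable_const)
    rw [iterInt, Ptr_Phi hvb, Ptr_Phi hva, integral_Phi_Phi hva1 hx, ← hγ1]
    have hm : Measurable fun z => chainVol γ (a + 1) b (Function.update x (a + 1) z) :=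
      (measurable_chainVol γ _ _).comp (measurable_update _)
    have h1 : ∫ z in S, iterInt v b (Phi (v b) (knotSeq x b)) d (a + 1) (Phi (v (a + 1)) z)
          ∂γ (a + 1) =
        ∫ z in S, (chainVol γ (a + 1) b (Function.update x (a + 1) z)).toReal ∂γ (a + 1) := by
      refine setIntegral_congr_fun hSm fun z hz => ?_
      have h := ih (a + 1) (Function.update x (a + 1) z)
        (fun k hk => hv k ⟨by have := hk.1; omega, by have := hk.2; omega⟩)
        (fun k hk => hγ k ⟨by have := hk.1; omega, by have := hk.2; omega⟩)
        (by rw [hb', hUb, hU]; exact hz.1.le)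
      rwa [hb', hUb, hU] at h
    rw [h1, integral_toReal hm.aemeasurable
      (Filter.Eventually.of_forall fun z => (chainVol_le_one γ _ _ _).trans_lt ENNReal.one_lt_top)]
    congr 1
    have h2 := lmarginal_mul_decrInd γ (a := a) (b := a + 1) (c := b) (by omega) (by omega)
      (φ := fun _ => 1) measurable_const (fun _ _ _ => rfl) x
    simp only [one_mul] at h2
    change _ = (∫⋯∫⁻_Finset.Ioo a b, (fun x => decrInd a b x) ∂γ) x
    rw [h2, ← lintegral_indicator hSm]
    -- the level `x b` belongs to `decr` but not to `S`
    refine lintegral_congr_ae ?_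
    filter_upwards [Measure.ae_ne (γ (a + 1)) (x b)] with z hz
    rw [chainVol_succ]
    have hiff : Function.update x (a + 1) z ∈ decr a (a + 1) ↔ (z : EReal) ≤ knotSeq x a := by
      constructor
      · intro h
        have := h a ⟨le_rfl, by omega⟩
        rwa [hU, hUa] at this
      · intro h k hk
        obtain rfl : k = a := by have := hk.1; have := hk.2; omega
        rwa [hU, hUa]
    by_cases h3 : (z : EReal) ≤ knotSeq x a
    · rw [decrInd, Set.indicator_of_mem (hiff.2 h3), Pi.one_apply, one_mul]
      by_cases h4 : knotSeq x b < z
      · rw [Set.indicator_of_mem (show z ∈ S from ⟨h4, h3⟩)]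
      · rw [Set.indicator_of_notMem (fun h : z ∈ S => h4 h.1), chainVol_eq_zero γ (by omega)]
        rw [hU, hUb, not_le]
        refine lt_of_le_of_ne (not_lt.1 h4) fun h => hz ?_
        rw [knotSeq_of_pos (by omega)] at h
        exact_mod_cast h
    · rw [Set.indicator_of_notMem (fun h : z ∈ S => h3 h.2), decrInd,
        Set.indicator_of_notMem (mt hiff.1 h3), zero_mul]

lemma Iab_eq_chainVol {v : ℕ → ℝ} {a b : ℕ} (hab : a < b) (x : ℕ → ℝ)
    (hv : ∀ k ∈ Set.Icc a b, 0 < v k) (hγ : ∀ k ∈ Set.Ioo a b, γ k = gauss (v k))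
    (hx : knotSeq x b ≤ knotSeq x a) :
    Iab v a b (Phi (v a) (knotSeq x a)) (Phi (v b) (knotSeq x b)) =
      (chainVol γ a b x).toReal := by
  obtain ⟨d, rfl⟩ : ∃ d, b = a + d + 1 := ⟨b - a - 1, by omega⟩
  rw [Iab, show a + d + 1 - a - 1 = d by omega]
  exact iterInt_eq_chainVol γ d a x hv hγ hx

lemma measurable_bridge_density (a b c : ℕ) : Measurable fun q : (ℕ → ℝ) × ℝ =>
    chainVol γ a b (Function.update q.1 b q.2) * chainVol γ b c (Function.update q.1 b q.2) :=
  ((measurable_chainVol γ _ _).comp measurable_update').mul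
    ((measurable_chainVol γ _ _).comp measurable_update')

instance (a b c : ℕ) (x : ℕ → ℝ) : IsFiniteMeasure (bridge γ a b c x) := by
  refine isFiniteMeasure_withDensity (ne_top_of_le_ne_top ENNReal.one_ne_top ?_)
  calc _ ≤ ∫⁻ _, 1 ∂γ b := lintegral_mono fun z =>
        mul_le_one' (chainVol_le_one _ _ _ _) (chainVol_le_one _ _ _ _)
    _ = 1 := by simp

/-- The conditional upper tail of `x b`, given that the sequence is nonincreasing and given its
values at `a` and `c`. -/
def tailProb (a b c : ℕ) (x : ℕ → ℝ) : ℝ :=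
  1 - (bridge γ a b c x (Set.Iic (x b)) / bridge γ a b c x Set.univ).toReal

lemma measurable_tailProb (a b c : ℕ) : Measurable (tailProb γ a b c) := by
  have h1 : Measurable fun x => bridge γ a b c x (Set.Iic (x b)) := by
    simp_rw [bridge_apply γ a b c _ measurableSet_Iic]
    refine Measurable.lintegral_prod_right' (f := fun q : (ℕ → ℝ) × ℝ =>
      (Set.Iic (q.1 b)).indicator (fun z => chainVol γ a b (Function.update q.1 b z) *
        chainVol γ b c (Function.update q.1 b z)) q.2) ?_
    have : MeasurableSet {q : (ℕ → ℝ) × ℝ | q.2 ≤ q.1 b} :=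
      measurableSet_le measurable_snd ((measurable_pi_apply b).comp measurable_fst)
    exact (measurable_bridge_density γ a b c).indicator this
  have h2 : Measurable fun x => bridge γ a b c x Set.univ := by
    simp_rw [bridge_apply γ a b c _ MeasurableSet.univ, Set.indicator_univ]
    exact (measurable_bridge_density γ a b c).lintegral_prod_right'
  exact measurable_const.sub (h1.div h2).ennreal_toReal

/-- Conditionally on the event that the sequence is nonincreasing and on all variables outside
`(a, c)`, the conditional tail probability `tailProb` is uniform. -/
lemma lmarginal_tailProb {a b c : ℕ} (hab : a < b) (hbc : b < c) [NullSingletonClass (γ b)]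
    {ψ : (ℕ → ℝ) → ℝ≥0∞} (hψ : Measurable ψ) (hψd : DependsOn ψ (Set.Ioo a c)ᶜ)
    {B : Set ℝ} (hB : MeasurableSet B) (x : ℕ → ℝ) :
    (∫⋯∫⁻_Finset.Ioo a c,
        (fun x => B.indicator 1 (tailProb γ a b c x) * ψ x * decrInd a c x) ∂γ) x =
      volume.restrict (Set.Ioo (0 : ℝ) 1) B *
        (∫⋯∫⁻_Finset.Ioo a c, (fun x => ψ x * decrInd a c x) ∂γ) x := by
  have hi : Measurable (B.indicator (1 : ℝ → ℝ≥0∞)) := measurable_one.indicator hB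
  have hsub : (Set.Ioo a c)ᶜ ⊆ (Set.Ioo a b ∪ Set.Ioo b c)ᶜ := by
    intro k; simp only [Set.mem_compl_iff, Set.mem_Ioo, Set.mem_union]; omega
  have hbr : ∀ z, bridge γ a b c (Function.update x b z) = bridge γ a b c x := fun z =>
    dependsOn_bridge γ hab hbc fun k hk => Function.update_of_ne
      (by rcases hk with rfl | rfl <;> omega) _ _
  have hψz : ∀ z, ψ (Function.update x b z) = ψ x := fun z =>
    hψd fun k hk => Function.update_of_ne (by rintro rfl; exact hk ⟨hab, hbc⟩) _ _
  have : NullSingletonClass (bridge γ a b c x) :=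
    ⟨fun z => withDensity_absolutelyContinuous _ _ (measure_singleton z)⟩
  have hd : Measurable fun z => chainVol γ a b (Function.update x b z) *
      chainVol γ b c (Function.update x b z) :=
    ((measurable_chainVol γ _ _).comp (measurable_update x)).mul
      ((measurable_chainVol γ _ _).comp (measurable_update x))
  have hg : Measurable fun z => B.indicator (1 : ℝ → ℝ≥0∞)
      (1 - (bridge γ a b c x (Set.Iic z) / bridge γ a b c x Set.univ).toReal) := by
    have hmono : Monotone fun z => bridge γ a b c x (Set.Iic z) := fun z w h =>
      measure_mono (Set.Iic_subset_Iic.2 h)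
    exact hi.comp (measurable_const.sub (hmono.measurable.div_const _).ennreal_toReal)
  rw [lmarginal_mul_decrInd γ hab hbc
      (φ := fun x => B.indicator 1 (tailProb γ a b c x) * ψ x)
      ((hi.comp (measurable_tailProb γ a b c)).mul hψ),
    lmarginal_mul_decrInd γ hab hbc hψ (hψd.mono hsub)]
  · simp_rw [tailProb, hbr, hψz, Function.update_self]
    have h1 : ∫⁻ z, B.indicator (1 : ℝ → ℝ≥0∞) (1 - (bridge γ a b c x (Set.Iic z) /
          bridge γ a b c x Set.univ).toReal) ∂(γ b).withDensity (fun z =>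
            chainVol γ a b (Function.update x b z) * chainVol γ b c (Function.update x b z)) =
        volume.restrict (Set.Ioo (0 : ℝ) 1) B * bridge γ a b c x Set.univ :=
      lintegral_indicator_tail (bridge γ a b c x) hB
    rw [lintegral_withDensity_eq_lintegral_mul _ hd hg] at h1
    have h2 : bridge γ a b c x Set.univ = ∫⁻ z, chainVol γ a b (Function.update x b z) *
        chainVol γ b c (Function.update x b z) ∂γ b := by
      rw [bridge_apply γ a b c _ MeasurableSet.univ, Set.indicator_univ]
    rw [lintegral_const_mul _ hd, ← h2, mul_left_comm, ← h1, ← lintegral_const_mul _ (hd.mul hg)]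
    refine lintegral_congr fun z => ?_
    simp only [Pi.mul_apply]
    ring
  · intro y y' hy
    have h1 : bridge γ a b c y = bridge γ a b c y' :=
      dependsOn_bridge γ hab hbc fun k hk => hy k (by
        simp only [Set.mem_compl_iff, Set.mem_Ioo, Set.mem_union]
        rcases hk with rfl | rfl <;> omega)
    have h2 : ψ y = ψ y' := hψd fun k hk => hy k (hsub hk)
    have h3 : y b = y' b := hy b (by simp)
    simp only [tailProb, h1, h2, h3]

/-- `F_abc` at a level `t` between the knots `c` and `a` is the mass of `(-∞, t]` for `bridge`. -/
lemma Fabc_eq_bridge {v : ℕ → ℝ} {a b c : ℕ} (hab : a < b) (hbc : b < c) (x : ℕ → ℝ)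
    (hv : ∀ k ∈ Set.Icc a c, 0 < v k) (hγ : ∀ k ∈ Set.Ioo a c, γ k = gauss (v k)) {t : EReal}
    (hct : knotSeq x c ≤ t) (hta : t ≤ knotSeq x a) :
    Fabc v (knotSeq x) a b c t = (bridge γ a b c x {z : ℝ | (z : EReal) ≤ t}).toReal := by
  have hvb := hv b ⟨hab.le, hbc.le⟩
  have hγb := hγ b ⟨hab, hbc⟩
  have : NullSingletonClass (γ b) := hγb ▸ nullSingletonClass_gauss hvb
  have hU : ∀ z, knotSeq (Function.update x b z) b = z := fun z => by
    rw [knotSeq_of_pos (by omega)]; simp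
  have hUa : ∀ z, knotSeq (Function.update x b z) a = knotSeq x a := fun z =>
    knotSeq_congr (Function.update_of_ne (by omega) _ _)
  have hUc : ∀ z, knotSeq (Function.update x b z) c = knotSeq x c := fun z =>
    knotSeq_congr (Function.update_of_ne (by omega) _ _)
  set S : Set ℝ := {z : ℝ | knotSeq x c < (z : EReal) ∧ (z : EReal) ≤ t} with hS
  have hTm : MeasurableSet {z : ℝ | (z : EReal) ≤ t} :=
    measurableSet_le measurable_coe_real_ereal measurable_const
  have hSm : MeasurableSet S :=
    (measurableSet_lt measurable_const measurable_coe_real_ereal).inter hTm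
  have hd : Measurable fun z => chainVol γ a b (Function.update x b z) *
      chainVol γ b c (Function.update x b z) :=
    ((measurable_chainVol γ _ _).comp (measurable_update x)).mul
      ((measurable_chainVol γ _ _).comp (measurable_update x))
  rw [Fabc, if_pos ⟨hct, hta⟩, integral_Phi_Phi hvb hct, ← hγb]
  have h1 : ∫ z in S, Iab v a b (Phi (v a) (knotSeq x a)) (Phi (v b) z) *
        Iab v b c (Phi (v b) z) (Phi (v c) (knotSeq x c)) ∂γ b =
      ∫ z in S, (chainVol γ a b (Function.update x b z) *
        chainVol γ b c (Function.update x b z)).toReal ∂γ b := by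
    refine setIntegral_congr_fun hSm fun z hz => ?_
    have e1 := Iab_eq_chainVol γ hab (Function.update x b z)
      (fun k hk => hv k ⟨hk.1, hk.2.trans hbc.le⟩) (fun k hk => hγ k ⟨hk.1, hk.2.trans hbc⟩)
      (by rw [hU, hUa]; exact hz.2.trans hta)
    have e2 := Iab_eq_chainVol γ hbc (Function.update x b z)
      (fun k hk => hv k ⟨hab.le.trans hk.1, hk.2⟩) (fun k hk => hγ k ⟨hab.trans hk.1, hk.2⟩)
      (by rw [hU, hUc]; exact hz.1.le)
    rw [hU, hUa] at e1
    rw [hU, hUc] at e2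
    simp only [e1, e2, ENNReal.toReal_mul]
  rw [h1, integral_toReal hd.aemeasurable (Filter.Eventually.of_forall fun z =>
    (mul_le_one' (chainVol_le_one γ _ _ _) (chainVol_le_one γ _ _ _)).trans_lt
      ENNReal.one_lt_top), ← lintegral_indicator hSm, bridge_apply γ a b c x hTm]
  congr 1
  -- the integral leaves out the level `x c`, and `chainVol γ b c` vanishes below it
  refine lintegral_congr_ae ?_
  filter_upwards [Measure.ae_ne (γ b) (x c)] with z hz
  by_cases h3 : (z : EReal) ≤ t
  · by_cases h4 : knotSeq x c < z
    · rw [Set.indicator_of_mem (show z ∈ S from ⟨h4, h3⟩), Set.indicator_of_mem (by exact h3)]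
    · rw [Set.indicator_of_notMem (fun h : z ∈ S => h4 h.1), Set.indicator_of_mem (by exact h3),
        chainVol_eq_zero γ hbc, mul_zero]
      rw [hU, hUc, not_le]
      refine lt_of_le_of_ne (not_lt.1 h4) fun h => hz ?_
      rw [knotSeq_of_pos (by omega)] at h
      exact_mod_cast h
  · rw [Set.indicator_of_notMem (fun h : z ∈ S => h3 h.2), Set.indicator_of_notMem (by exact h3)]

/-- The quotient defining the p-value is the conditional tail probability. -/
lemma one_sub_Fabc_div_Fabc {v : ℕ → ℝ} {a b c : ℕ} (hab : a < b) (hbc : b < c) (x : ℕ → ℝ)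
    (hv : ∀ k ∈ Set.Icc a c, 0 < v k) (hγ : ∀ k ∈ Set.Ioo a c, γ k = gauss (v k))
    (hcb : knotSeq x c ≤ knotSeq x b) (hba : knotSeq x b ≤ knotSeq x a) :
    1 - Fabc v (knotSeq x) a b c (knotSeq x b) / Fabc v (knotSeq x) a b c (knotSeq x a) =
      tailProb γ a b c x := by
  rw [Fabc_eq_bridge γ hab hbc x hv hγ hcb hba, Fabc_eq_bridge γ hab hbc x hv hγ (hcb.trans hba)
    le_rfl, tailProb, ENNReal.toReal_div]
  have h1 : {z : ℝ | (z : EReal) ≤ knotSeq x b} = Set.Iic (x b) := by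
    ext z; rw [knotSeq_of_pos (by omega)]; simp
  have hTm : MeasurableSet {z : ℝ | (z : EReal) ≤ knotSeq x a} :=
    measurableSet_le measurable_coe_real_ereal measurable_const
  have h2 : bridge γ a b c x {z : ℝ | (z : EReal) ≤ knotSeq x a} = bridge γ a b c x Set.univ := by
    rw [bridge_apply γ a b c x hTm, bridge_apply γ a b c x MeasurableSet.univ, Set.indicator_univ]
    refine lintegral_congr fun z => ?_
    by_cases h : (z : EReal) ≤ knotSeq x a
    · rw [Set.indicator_of_mem (by exact h)]
    · rw [Set.indicator_of_notMem (by exact h), chainVol_eq_zero γ hab, zero_mul]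
      rwa [knotSeq_of_pos (by omega), knotSeq_congr (k := a) (y := x)
        (Function.update_of_ne hab.ne _ _), Function.update_self]
  rw [h1, h2]

end Chain

/-! ### Geometry of the active columns -/

section Geometry

variable {n p : ℕ} (X : Matrix (Fin n) (Fin p) ℝ) (i : ℕ → SignedVar p)

lemma inner_col_toLp (j : Fin p) (y : EuclideanSpace ℝ (Fin n)) :
    ⟪col X j, y⟫ = (Xᵀ *ᵥ WithLp.ofLp y) j := by
  simp [col, PiLp.inner_apply, mulVec, dotProduct, mul_comm]

lemma inner_col_col (j l : Fin p) : ⟪col X j, col X l⟫ = (Xᵀ * X) j l := by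
  rw [inner_col_toLp]; rfl

lemma sgn_mul_self (v : SignedVar p) : sgn v * sgn v = 1 := by
  rcases Int.units_eq_one_or v.2 with h | h <;> simp [sgn, h]

lemma abs_sgn (v : SignedVar p) : |sgn v| = 1 := by
  rcases Int.units_eq_one_or v.2 with h | h <;> simp [sgn, h]

variable {i} in
lemma colSpan_congr {i' : ℕ → SignedVar p} {k : ℕ} (h : ∀ l ∈ Set.Icc 1 k, i l = i' l) :
    colSpan X i k = colSpan X i' k := by
  unfold colSpan
  congr 1
  exact Set.image_congr fun l hl => by rw [h l hl]

variable {i} in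
lemma thetaBar_congr {i' : ℕ → SignedVar p} {k : ℕ} (h : ∀ l ∈ Set.Icc 1 k, i l = i' l) :
    thetaBar X i k = thetaBar X i' k := by
  have h' : ∀ l : Fin k, i (l + 1) = i' (l + 1) := fun l => h _ ⟨by omega, by omega⟩
  funext j
  simp only [thetaBar, gram, h']

lemma colSpan_mono {k k' : ℕ} (h : k ≤ k') : colSpan X i k ≤ colSpan X i k' :=
  Submodule.span_mono (Set.image_mono (Set.Icc_subset_Icc_right h))

lemma col_mem_colSpan {k l : ℕ} (hl : l ∈ Set.Icc 1 k) : col X (i l).1 ∈ colSpan X i k :=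
  Submodule.subset_span ⟨l, hl, rfl⟩

lemma mem_orthogonal_colSpan {k : ℕ} {z : EuclideanSpace ℝ (Fin n)}
    (h : ∀ l ∈ Set.Icc 1 k, ⟪col X (i l).1, z⟫ = 0) : z ∈ (colSpan X i k)ᗮ := by
  rw [Submodule.mem_orthogonal]
  intro u hu
  induction hu using Submodule.span_induction with
  | mem x hx => obtain ⟨l, hl, rfl⟩ := hx; exact h l hl
  | zero => simp
  | add x y _ _ hx hy => rw [inner_add_left, hx, hy, add_zero]
  | smul c x _ hx => rw [inner_smul_left, hx, mul_zero]

/-- The combination of the first `k` columns of the sequence with coefficients `b`. -/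
def comb (k : ℕ) (b : Fin k → ℝ) : EuclideanSpace ℝ (Fin n) := ∑ l, b l • col X (i (l + 1)).1

lemma comb_mem (k : ℕ) (b : Fin k → ℝ) : comb X i k b ∈ colSpan X i k :=
  Submodule.sum_mem _ fun l _ =>
    Submodule.smul_mem _ _ (col_mem_colSpan X i ⟨by omega, by omega⟩)

lemma inner_comb (k : ℕ) (b : Fin k → ℝ) (j : Fin p) :
    ⟪col X j, comb X i k b⟫ = (fun l : Fin k => (Xᵀ * X) j (i (l + 1)).1) ⬝ᵥ b := by
  simp [comb, inner_sum, inner_smul_right, inner_col_col, dotProduct, mul_comm]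

lemma inner_comb_gram (k : ℕ) (b : Fin k → ℝ) (m : Fin k) :
    ⟪col X (i (m + 1)).1, comb X i k b⟫ = (gram X i k *ᵥ b) m := by
  rw [inner_comb]; rfl

/-- The equiangular vector: the combination of the first `k` columns whose inner product with each
of them is the corresponding sign. -/
def equiangular (k : ℕ) : EuclideanSpace ℝ (Fin n) :=
  comb X i k ((gram X i k)⁻¹ *ᵥ fun l : Fin k => sgn (i (l + 1)))

lemma inner_equiangular (k : ℕ) (j : Fin p) : ⟪col X j, equiangular X i k⟫ = thetaBar X i k j :=
  inner_comb X i k _ j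

lemma thetaBar_of_mem {k l : ℕ} (hk : IsUnit (gram X i k).det) (hl : l ∈ Set.Icc 1 k) :
    thetaBar X i k (i l).1 = sgn (i l) := by
  obtain ⟨m, rfl⟩ : ∃ m : Fin k, l = m + 1 := ⟨⟨l - 1, by have := hl.1; have := hl.2; omega⟩, by
    have := hl.1; simp; omega⟩
  rw [← inner_equiangular, equiangular, inner_comb_gram, mulVec_mulVec, mul_nonsing_inv _ hk,
    one_mulVec]

lemma thetaBar_zero (j : Fin p) : thetaBar X i 0 j = 0 := by simp [thetaBar]

/-- The correlation of the `j`-th column with the residual of `y` after projection on the first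
`k` columns. -/
def corr (k : ℕ) (y : EuclideanSpace ℝ (Fin n)) (j : Fin p) : ℝ :=
  ⟪col X j, (colSpan X i k)ᗮ.starProjection y⟫

lemma corr_eq_inner (k : ℕ) (y : EuclideanSpace ℝ (Fin n)) (j : Fin p) :
    corr X i k y j = ⟪(colSpan X i k)ᗮ.starProjection (col X j), y⟫ :=
  (Submodule.inner_starProjection_left_eq_right _ _ _).symm

lemma corr_zero (y : EuclideanSpace ℝ (Fin n)) (j : Fin p) : corr X i 0 y j = ⟪col X j, y⟫ := by
  have h : y ∈ (colSpan X i 0)ᗮ := mem_orthogonal_colSpan X i fun l hl => by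
    have := hl.1; have := hl.2; omega
  rw [corr, Submodule.starProjection_eq_self_iff.2 h]

/-- At the level `lam` at which the residual correlation of the entering variable reaches
`sgn (i (k + 1)) * lam`, the residual correlations of all variables can be computed from the first
`k` or from the first `k + 1` columns: they pass continuously from one step to the next. -/
lemma corr_add_thetaBar_succ {k : ℕ} (hk : IsUnit (gram X i k).det)
    (hk' : IsUnit (gram X i (k + 1)).det) {y : EuclideanSpace ℝ (Fin n)} {lam : ℝ}
    (h : corr X i k y (i (k + 1)).1 =
      lam * (sgn (i (k + 1)) - thetaBar X i k (i (k + 1)).1)) (j : Fin p) :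
    corr X i k y j + lam * thetaBar X i k j =
      corr X i (k + 1) y j + lam * thetaBar X i (k + 1) j := by
  set P := (colSpan X i k).starProjection y with hP
  set P' := (colSpan X i (k + 1)).starProjection y with hP'
  have hc : ∀ j, corr X i k y j = ⟪col X j, y⟫ - ⟪col X j, P⟫ := fun j => by
    rw [corr, Submodule.starProjection_orthogonal_val, inner_sub_right]
  have hc' : ∀ j, corr X i (k + 1) y j = ⟪col X j, y⟫ - ⟪col X j, P'⟫ := fun j => by
    rw [corr, Submodule.starProjection_orthogonal_val, inner_sub_right]
  have hproj : ∀ (m : ℕ), ∀ l ∈ Set.Icc 1 m,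
      ⟪col X (i l).1, (colSpan X i m).starProjection y⟫ = ⟪col X (i l).1, y⟫ := fun m l hl => by
    have := Submodule.starProjection_inner_eq_zero (K := colSpan X i m) y _
      (col_mem_colSpan X i hl)
    rw [inner_sub_left, sub_eq_zero] at this
    rw [real_inner_comm, ← this, real_inner_comm]
  -- the difference of the two sides is the inner product with a vector of `H ∩ Hᗮ`
  set z := (P' - P) - lam • (equiangular X i (k + 1) - equiangular X i k) with hz
  have hmem : z ∈ colSpan X i (k + 1) := by
    have hsub := colSpan_mono X i (Nat.le_succ k)
    exact Submodule.sub_mem _ (Submodule.sub_mem _ (Submodule.starProjection_apply_mem _ _)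
      (hsub (Submodule.starProjection_apply_mem _ _))) (Submodule.smul_mem _ _
        (Submodule.sub_mem _ (comb_mem X i _ _) (hsub (comb_mem X i _ _))))
  have hinner : ∀ j, ⟪col X j, z⟫ = (corr X i k y j - corr X i (k + 1) y j) -
      lam * (thetaBar X i (k + 1) j - thetaBar X i k j) := fun j => by
    rw [hz, inner_sub_right, inner_sub_right, inner_smul_right, inner_sub_right,
      inner_equiangular, inner_equiangular, hc, hc']
    ring
  have horth : z ∈ (colSpan X i (k + 1))ᗮ := by
    refine mem_orthogonal_colSpan X i fun l hl => ?_
    rw [hinner, thetaBar_of_mem X i hk' hl, hc', hproj (k + 1) l hl, sub_self, sub_zero]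
    rcases Nat.lt_or_ge k l with hkl | hkl
    · obtain rfl : l = k + 1 := le_antisymm hl.2 hkl
      rw [h]; ring
    · have hl' : l ∈ Set.Icc 1 k := ⟨hl.1, hkl⟩
      rw [thetaBar_of_mem X i hk hl', hc, hproj k l hl']; ring
  have h0 : z = 0 := by
    have := (Submodule.mem_orthogonal _ _).1 horth z hmem
    exact inner_self_eq_zero.1 this
  have := hinner j
  rw [h0, inner_zero_right] at this
  linarith

/-- The residual variance in the definition of `ρ` (a Schur complement) is a squared distance. -/
lemma norm_sq_orthogonal_col {k : ℕ} (hk : IsUnit (gram X i k).det) (j : Fin p) :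
    ‖(colSpan X i k)ᗮ.starProjection (col X j)‖ ^ 2 =
      (Xᵀ * X) j j - (fun l : Fin k => (Xᵀ * X) j (i (l + 1)).1) ⬝ᵥ
        ((gram X i k)⁻¹ *ᵥ fun l : Fin k => (Xᵀ * X) j (i (l + 1)).1) := by
  set r : Fin k → ℝ := fun l : Fin k => (Xᵀ * X) j (i (l + 1)).1 with hr
  have hP : comb X i k ((gram X i k)⁻¹ *ᵥ r) = (colSpan X i k).starProjection (col X j) := by
    symm
    refine Submodule.eq_starProjection_of_mem_orthogonal (comb_mem X i _ _) ?_
    refine mem_orthogonal_colSpan X i fun l hl => ?_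
    obtain ⟨m, rfl⟩ : ∃ m : Fin k, l = m + 1 := ⟨⟨l - 1, by have := hl.1; have := hl.2; omega⟩, by
      have := hl.1; simp; omega⟩
    rw [inner_sub_right, inner_comb_gram, mulVec_mulVec, mul_nonsing_inv _ hk, one_mulVec,
      real_inner_comm, inner_col_col, hr, sub_self]
  have h1 : ⟪col X j, (colSpan X i k).starProjection (col X j)⟫ = r ⬝ᵥ ((gram X i k)⁻¹ *ᵥ r) := by
    rw [← hP, inner_comb]
  rw [← h1, ← inner_col_col, ← inner_sub_right, ← Submodule.starProjection_orthogonal_val,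
    ← real_inner_self_eq_norm_sq, Submodule.inner_starProjection_left_eq_right,
    Submodule.starProjection_eq_self_iff.2 (Submodule.starProjection_apply_mem _ _)]

lemma starProjection_col_ne_zero {k : ℕ} (hk' : IsUnit (gram X i (k + 1)).det) :
    (colSpan X i k)ᗮ.starProjection (col X (i (k + 1)).1) ≠ 0 := by
  intro h0
  -- the columns are linearly independent since their Gram matrix is invertible
  have hli : LinearIndependent ℝ fun l : Fin (k + 1) => col X (i (l + 1)).1 := by
    rw [Fintype.linearIndependent_iff]
    intro b hb
    have h1 : gram X i (k + 1) *ᵥ b = 0 := by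
      ext m
      rw [← inner_comb_gram, comb, hb, inner_zero_right, Pi.zero_apply]
    have h2 : b = 0 := by
      have := congrArg ((gram X i (k + 1))⁻¹ *ᵥ ·) h1
      simpa [mulVec_mulVec, nonsing_inv_mul _ hk'] using this
    simp [h2]
  have h2 := (linearIndependent_finSucc'.1 hli).2
  apply h2
  rw [Submodule.starProjection_orthogonal_val, sub_eq_zero] at h0
  have h3 : col X (i (k + 1)).1 ∈ colSpan X i k := by
    rw [h0]; exact Submodule.starProjection_apply_mem _ _
  refine Submodule.span_mono ?_ h3
  rintro _ ⟨l, hl, rfl⟩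
  refine ⟨⟨l - 1, by have := hl.1; have := hl.2; omega⟩, ?_⟩
  have : l - 1 + 1 = l := by have := hl.1; omega
  simp [Fin.init, this]

lemma M_eq (k : ℕ) : M X i k = diagonal (fun l : Fin k => sgn (i (l + 1))) * gram X i k *
    diagonal (fun l : Fin k => sgn (i (l + 1))) := by
  ext l m
  simp only [M, of_apply, R, mul_diagonal, diagonal_mul, gram]
  ring

lemma M_inv (k : ℕ) : (M X i k)⁻¹ = diagonal (fun l : Fin k => sgn (i (l + 1))) *
    (gram X i k)⁻¹ * diagonal (fun l : Fin k => sgn (i (l + 1))) := by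
  have h : (diagonal (fun l : Fin k => sgn (i (l + 1))))⁻¹ =
      diagonal (fun l : Fin k => sgn (i (l + 1))) := by
    apply inv_eq_left_inv
    rw [diagonal_mul_diagonal]
    simp [sgn_mul_self]
  rw [M_eq, Matrix.mul_inv_rev, Matrix.mul_inv_rev, h, Matrix.mul_assoc]

/-- The signs in `M` and `row` cancel, except for that of `j`. -/
lemma row_dotProduct_M_inv (k : ℕ) (j : SignedVar p) (b : Fin k → ℝ) :
    row X i k j ⬝ᵥ ((M X i k)⁻¹ *ᵥ b) =
      sgn j * ((fun l : Fin k => (Xᵀ * X) j.1 (i (l + 1)).1) ⬝ᵥ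
        ((gram X i k)⁻¹ *ᵥ fun l : Fin k => sgn (i (l + 1)) * b l)) := by
  have h1 : diagonal (fun l : Fin k => sgn (i (l + 1))) *ᵥ b =
      fun l : Fin k => sgn (i (l + 1)) * b l := by
    ext l; rw [mulVec_diagonal]
  rw [M_inv, Matrix.mul_assoc, ← mulVec_mulVec, ← mulVec_mulVec, h1]
  simp only [dotProduct, mulVec_diagonal, Finset.mul_sum, row, R]
  refine Finset.sum_congr rfl fun l _ => ?_
  linear_combination (sgn j * (Xᵀ * X) j.1 (i (l + 1)).1 *
    ((gram X i k)⁻¹ *ᵥ fun l : Fin k => sgn (i (l + 1)) * b l) l) * sgn_mul_self (i (l + 1))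

lemma theta_eq (k : ℕ) (j : SignedVar p) : theta X i k j = sgn j * thetaBar X i k j.1 := by
  rw [theta, row_dotProduct_M_inv]
  simp [thetaBar]

/-- `ρ_{k+1}` in terms of the part of the entering column that is orthogonal to the first `k`. -/
lemma rho_succ {k : ℕ} (hk : IsUnit (gram X i k).det) :
    rho X i (k + 1) = ‖(colSpan X i k)ᗮ.starProjection (col X (i (k + 1)).1)‖ /
      (1 - sgn (i (k + 1)) * thetaBar X i k (i (k + 1)).1) := by
  rw [rho, theta_eq]
  congr 1
  have h1 : (fun l : Fin k => sgn (i (l + 1)) * row X i k (i (k + 1)) l) =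
      sgn (i (k + 1)) • fun l : Fin k => (Xᵀ * X) (i (k + 1)).1 (i (l + 1)).1 := by
    ext l
    simp only [row, R, Pi.smul_apply, smul_eq_mul]
    linear_combination (sgn (i (k + 1)) * (Xᵀ * X) (i (k + 1)).1 (i (l + 1)).1) *
      sgn_mul_self (i (l + 1))
  rw [row_dotProduct_M_inv, h1, mulVec_smul, dotProduct_smul, smul_eq_mul, ← mul_assoc,
    sgn_mul_self, one_mul, R, sgn_mul_self, one_mul, ← norm_sq_orthogonal_col X i hk]
  exact Real.sqrt_sq (norm_nonneg _)

variable {i} in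
lemma rho_congr {i' : ℕ → SignedVar p} {k : ℕ} (h : ∀ l ∈ Set.Icc 1 k, i l = i' l) :
    rho X i k = rho X i' k := by
  cases k with
  | zero => rfl
  | succ k =>
    have h' : ∀ l : Fin k, i (l + 1) = i' (l + 1) := fun l => h _ ⟨by omega, by omega⟩
    have h1 : i (k + 1) = i' (k + 1) := h _ ⟨by omega, le_rfl⟩
    have h2 : row X i k = row X i' k := by
      ext j l
      simp only [row, h']
    simp only [rho, theta, M, h2, h', h1]

end Geometry

/-! ### The level at which a line of correlations reaches the diagonal -/

/-- The smallest level `β ≥ 0` from which on `|A + β θ| ≤ β`, for `|θ| < 1`. -/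
def hit (A θ : ℝ) : ℝ := max (A / (1 - θ)) (-A / (1 + θ))

lemma abs_add_mul_le_iff {A θ : ℝ} (hθ : |θ| < 1) (β : ℝ) : |A + β * θ| ≤ β ↔ hit A θ ≤ β := by
  obtain ⟨h1, h2⟩ := abs_lt.1 hθ
  rw [hit, max_le_iff, div_le_iff₀ (by linarith), div_le_iff₀ (by linarith), abs_le]
  constructor <;> rintro ⟨h, h'⟩ <;> constructor <;> linarith

lemma abs_add_mul_lt_iff {A θ : ℝ} (hθ : |θ| < 1) (β : ℝ) : |A + β * θ| < β ↔ hit A θ < β := by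
  obtain ⟨h1, h2⟩ := abs_lt.1 hθ
  rw [hit, max_lt_iff, div_lt_iff₀ (by linarith), div_lt_iff₀ (by linarith), abs_lt]
  constructor <;> rintro ⟨h, h'⟩ <;> constructor <;> linarith

lemma abs_add_mul_eq_iff {A θ : ℝ} (hθ : |θ| < 1) (β : ℝ) : |A + β * θ| = β ↔ hit A θ = β := by
  have h1 := abs_add_mul_le_iff (A := A) hθ β
  have h2 := abs_add_mul_lt_iff (A := A) hθ β
  constructor <;> intro h
  · exact le_antisymm (h1.1 h.le) (not_lt.1 (mt h2.2 (by rw [h]; exact lt_irrefl _)))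
  · exact le_antisymm (h1.2 h.le) (not_lt.1 (mt h2.1 (by rw [h]; exact lt_irrefl _)))

lemma hit_nonneg {A θ : ℝ} (hθ : |θ| < 1) : 0 ≤ hit A θ :=
  (abs_nonneg _).trans ((abs_add_mul_le_iff hθ _).2 le_rfl)

lemma hit_zero_right (A : ℝ) : hit A 0 = |A| := by simp [hit, abs]

/-! ### The path along a fixed sequence of signed variables -/

section Path

variable {n p : ℕ}

lemma argmaxOn_spec [NeZero p] {s : Finset (Fin p)} (hs : s.Nonempty) (f : Fin p → ℝ) :
    argmaxOn s f ∈ s ∧ ∀ l ∈ s, f l ≤ f (argmaxOn s f) := by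
  have h : (s.filter fun j => ∀ l ∈ s, f l ≤ f j).Nonempty := by
    obtain ⟨j, hj, hj'⟩ := s.exists_max_image f hs
    exact ⟨j, Finset.mem_filter.2 ⟨hj, hj'⟩⟩
  rw [argmaxOn, dif_pos h]
  exact Finset.mem_filter.1 (Finset.min'_mem _ h)

variable (X : Matrix (Fin n) (Fin p) ℝ) (i : ℕ → SignedVar p)

/-- The variables that do not occur among the first `k` of the sequence. -/
def unused (k : ℕ) : Finset (Fin p) := Finset.univ \ (Finset.Icc 1 k).image fun l => (i l).1

variable {i} in
lemma mem_unused {k : ℕ} {j : Fin p} : j ∈ unused i k ↔ ∀ l ∈ Set.Icc 1 k, (i l).1 ≠ j := by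
  simp [unused]

lemma unused_zero : unused i 0 = Finset.univ := by simp [unused]

variable {i} in
lemma unused_congr {i' : ℕ → SignedVar p} {k : ℕ} (h : ∀ l ∈ Set.Icc 1 k, i l = i' l) :
    unused i k = unused i' k := by
  ext j
  rw [mem_unused, mem_unused]
  exact forall₂_congr fun l hl => by rw [h l hl]

lemma unused_nonempty {k : ℕ} (hk : k < p) : (unused i k).Nonempty := by
  rw [← Finset.card_pos, unused, Finset.card_sdiff_of_subset (Finset.subset_univ _),
    Finset.card_univ, Fintype.card_fin]
  have := Finset.card_image_le (s := Finset.Icc 1 k) (f := fun l => (i l).1)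
  simp only [Nat.card_Icc, add_tsub_cancel_right] at this
  omega

/-- The linear form that gives the `k`-th knot (`k ≥ 1`) is the inner product with this vector. -/
def knotDir (k : ℕ) : EuclideanSpace ℝ (Fin n) :=
  (sgn (i k) / (1 - sgn (i k) * thetaBar X i (k - 1) (i k).1)) •
    (colSpan X i (k - 1))ᗮ.starProjection (col X (i k).1)

variable {X i} {y : EuclideanSpace ℝ (Fin n)} {k K : ℕ}

lemma sgn_signOf (j : Fin p) (x : ℝ) : sgn (j, signOf x) * x = |x| := by
  unfold sgn signOf
  split_ifs with h
  · simp [abs_of_nonneg h]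
  · simp [abs_of_neg (not_le.1 h)]

lemma IrrCheck.isUnit_det (h : IrrCheck X i K) (hk : k ≤ K) : IsUnit (gram X i k).det := by
  rcases Nat.eq_zero_or_pos k with rfl | hk0
  · simp
  · exact (h.2 k ⟨hk0, hk⟩).1

lemma IrrCheck.abs_thetaBar_lt (h : IrrCheck X i K) (hk : k ≤ K) {j : Fin p}
    (hj : j ∈ unused i k) : |thetaBar X i k j| < 1 := by
  rcases Nat.eq_zero_or_pos k with rfl | hk0
  · simp [thetaBar_zero]
  · exact (h.2 k ⟨hk0, hk⟩).2 j (mem_unused.1 hj)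

lemma IrrCheck.mem_unused (h : IrrCheck X i K) (hk : k < K) : (i (k + 1)).1 ∈ unused i k := by
  rw [LAR.mem_unused]
  intro l hl heq
  have := h.1 (show l ∈ Set.Icc 1 K from ⟨hl.1, by have := hl.2; omega⟩)
    (show k + 1 ∈ Set.Icc 1 K from ⟨by omega, by omega⟩) heq
  have := hl.2
  omega

lemma one_sub_sgn_mul_pos (v : SignedVar p) {θ : ℝ} (hθ : |θ| < 1) : 0 < 1 - sgn v * θ := by
  have : |sgn v * θ| < 1 := by rwa [abs_mul, abs_sgn, one_mul]
  linarith [(abs_lt.1 this).2]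

lemma corr_eq_knotDir (hθ : |thetaBar X i k (i (k + 1)).1| < 1) :
    corr X i k y (i (k + 1)).1 =
      ⟪knotDir X i (k + 1), y⟫ * (sgn (i (k + 1)) - thetaBar X i k (i (k + 1)).1) := by
  have h := one_sub_sgn_mul_pos (i (k + 1)) hθ
  have h2 := sgn_mul_self (i (k + 1))
  have hd : ⟪knotDir X i (k + 1), y⟫ = sgn (i (k + 1)) /
      (1 - sgn (i (k + 1)) * thetaBar X i k (i (k + 1)).1) * corr X i k y (i (k + 1)).1 := by
    rw [corr_eq_inner]
    exact real_inner_smul_left _ _ _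
  rw [hd, div_mul_eq_mul_div, div_mul_eq_mul_div, eq_div_iff h.ne']
  linear_combination (- corr X i k y (i (k + 1)).1) * h2

variable [NeZero p]

variable (X i) in
/-- The level of the knot that follows the first `k` variables of the sequence: the largest level at
which the residual correlation of an unused variable reaches the level. -/
def nextKnot (k : ℕ) (y : EuclideanSpace ℝ (Fin n)) : ℝ :=
  let g : Fin p → ℝ := fun j => hit (corr X i k y j) (thetaBar X i k j)
  g (argmaxOn (unused i k) g)

variable (X i) in
/-- The signed variable that enters after the first `k` variables of the sequence. -/
def nextVar (k : ℕ) (y : EuclideanSpace ℝ (Fin n)) : SignedVar p :=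
  let N : Fin p → ℝ := fun j => corr X i k y j + nextKnot X i k y * thetaBar X i k j
  let j := argmaxOn (unused i k) fun j => |N j|
  (j, signOf (N j))

lemma nextKnot_spec (hk : k < p) (hθ : ∀ j ∈ unused i k, |thetaBar X i k j| < 1) :
    (∃ j ∈ unused i k, hit (corr X i k y j) (thetaBar X i k j) = nextKnot X i k y) ∧
      ∀ j ∈ unused i k, |corr X i k y j + nextKnot X i k y * thetaBar X i k j| ≤
        nextKnot X i k y := by
  have h := argmaxOn_spec (unused_nonempty i hk)
    fun j => hit (corr X i k y j) (thetaBar X i k j)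
  exact ⟨⟨_, h.1, rfl⟩, fun j hj => (abs_add_mul_le_iff (hθ j hj) _).2 (h.2 j hj)⟩

lemma nextKnot_nonneg (hk : k < p) (hθ : ∀ j ∈ unused i k, |thetaBar X i k j| < 1) :
    0 ≤ nextKnot X i k y := by
  obtain ⟨⟨j, hj, h⟩, -⟩ := nextKnot_spec (y := y) hk hθ
  exact h ▸ hit_nonneg (hθ j hj)

lemma nextVar_spec (hk : k < p) (hθ : ∀ j ∈ unused i k, |thetaBar X i k j| < 1) :
    (nextVar X i k y).1 ∈ unused i k ∧
      sgn (nextVar X i k y) * (corr X i k y (nextVar X i k y).1 +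
        nextKnot X i k y * thetaBar X i k (nextVar X i k y).1) = nextKnot X i k y := by
  have h := argmaxOn_spec (unused_nonempty i hk)
    fun j => |corr X i k y j + nextKnot X i k y * thetaBar X i k j|
  obtain ⟨⟨j, hj, hj'⟩, hle⟩ := nextKnot_spec (y := y) hk hθ
  refine ⟨h.1, ?_⟩
  refine (sgn_signOf _ _).trans ?_
  refine le_antisymm (hle _ h.1) ?_
  exact ((abs_add_mul_eq_iff (hθ j hj) _).2 hj').symm.le.trans (h.2 j hj)

/-- The next variable is `v` as soon as the residual correlation of `v` reaches a positive level
at which the residual correlations of all other unused variables are strictly smaller. -/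
lemma nextVar_eq (hk : k < p) (hθ : ∀ j ∈ unused i k, |thetaBar X i k j| < 1) {v : SignedVar p}
    (hv : v.1 ∈ unused i k) {lam : ℝ} (hlam : 0 < lam)
    (hvl : corr X i k y v.1 + lam * thetaBar X i k v.1 = sgn v * lam)
    (hlt : ∀ j ∈ unused i k, j ≠ v.1 → |corr X i k y j + lam * thetaBar X i k j| < lam) :
    nextKnot X i k y = lam ∧ nextVar X i k y = v := by
  have habs : |corr X i k y v.1 + lam * thetaBar X i k v.1| = lam := by
    rw [hvl, abs_mul, abs_sgn, one_mul, abs_of_pos hlam]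
  have hle : ∀ j ∈ unused i k, hit (corr X i k y j) (thetaBar X i k j) ≤ lam := by
    intro j hj
    rw [← abs_add_mul_le_iff (hθ j hj)]
    by_cases hjv : j = v.1
    · rw [hjv, habs]
    · exact (hlt j hj hjv).le
  obtain ⟨⟨j, hj, hj'⟩, hle'⟩ := nextKnot_spec (y := y) hk hθ
  have hK : nextKnot X i k y = lam := by
    refine le_antisymm (hj' ▸ hle j hj) ?_
    rw [← (abs_add_mul_eq_iff (hθ _ hv) _).1 habs]
    exact (abs_add_mul_le_iff (hθ _ hv) _).1 (hle' _ hv)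
  refine ⟨hK, ?_⟩
  have hs := nextVar_spec (y := y) hk hθ
  rw [hK] at hs
  have h1 : (nextVar X i k y).1 = v.1 := by
    by_contra hne
    have := hlt _ hs.1 hne
    have h2 : |sgn (nextVar X i k y) * (corr X i k y (nextVar X i k y).1 +
        lam * thetaBar X i k (nextVar X i k y).1)| = lam := by rw [hs.2, abs_of_pos hlam]
    rw [abs_mul, abs_sgn, one_mul] at h2
    exact this.ne h2
  have h2 : sgn (nextVar X i k y) * sgn v = 1 := by
    have h3 := hs.2
    rw [h1, hvl, ← mul_assoc] at h3
    exact mul_right_cancel₀ hlam.ne' (h3.trans (one_mul lam).symm)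
  refine Prod.ext h1 ?_
  unfold sgn at h2
  rcases Int.units_eq_one_or (nextVar X i k y).2 with h | h <;>
    rcases Int.units_eq_one_or v.2 with h' | h' <;> rw [h, h'] at h2 ⊢ <;> norm_num at h2

/-- The first `k` variables of the path of `y` are those of the sequence `i`, and the `k + 1`-st
variable, its knot and its residual correlations are given by the closed forms in terms of the
projection of `y` off the first `k` columns. -/
structure Follows (X : Matrix (Fin n) (Fin p) ℝ) (i : ℕ → SignedVar p)
    (y : EuclideanSpace ℝ (Fin n)) (k : ℕ) : Prop where
  idx : ∀ l ∈ Set.Icc 1 k, (state X y k).idx l = i l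
  var : (state X y k).idx (k + 1) = nextVar X i k y
  knot : (state X y k).knot = nextKnot X i k y
  resid : ∀ j, (state X y k).resid j = corr X i k y j + nextKnot X i k y * thetaBar X i k j

lemma follows_zero : Follows X i y 0 := by
  have h0 : ∀ j, corr X i 0 y j = (Xᵀ *ᵥ WithLp.ofLp y) j := fun j => by
    rw [corr_zero, inner_col_toLp]
  have hN : ∀ lam : ℝ, ∀ j, corr X i 0 y j + lam * thetaBar X i 0 j =
      (Xᵀ *ᵥ WithLp.ofLp y) j := fun lam j => by rw [h0, thetaBar_zero, mul_zero, add_zero]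
  refine ⟨fun l hl => by have := hl.1; have := hl.2; omega, ?_, ?_, fun j => ?_⟩
  · simp only [nextVar, hN, unused_zero]
    rfl
  · simp only [nextKnot, h0, unused_zero, thetaBar_zero, hit_zero_right]
    rfl
  · rw [hN]
    rfl

lemma Follows.index_eq (h : Follows X i y k) : index X y (k + 1) = nextVar X i k y := h.var

lemma Follows.knot_eq (h : Follows X i y k) : LAR.knot X y (k + 1) = nextKnot X i k y := h.knot

/-- One step of the algorithm, when the entering variable is the one of the sequence. -/
lemma Follows.succ (hirr : IrrCheck X i K) (hk : k < K) (hKp : K < p) (h : Follows X i y k)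
    (hi : nextVar X i k y = i (k + 1)) :
    nextKnot X i k y = ⟪knotDir X i (k + 1), y⟫ ∧ Follows X i y (k + 1) ∧
      nextKnot X i (k + 1) y ≤ nextKnot X i k y := by
  have hθ : ∀ j ∈ unused i k, |thetaBar X i k j| < 1 := fun j hj => hirr.abs_thetaBar_lt hk.le hj
  have hθ' : ∀ j ∈ unused i (k + 1), |thetaBar X i (k + 1) j| < 1 := fun j hj =>
    hirr.abs_thetaBar_lt hk hj
  have hkp : k < p := by omega
  set lam := nextKnot X i k y with hlam
  have hs := (nextVar_spec (y := y) hkp hθ).2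
  rw [hi, ← hlam] at hs
  have hss := sgn_mul_self (i (k + 1))
  have hA : corr X i k y (i (k + 1)).1 =
      lam * (sgn (i (k + 1)) - thetaBar X i k (i (k + 1)).1) := by
    linear_combination sgn (i (k + 1)) * hs - (corr X i k y (i (k + 1)).1 +
        lam * thetaBar X i k (i (k + 1)).1) * hss
  have hθi := hθ _ (hirr.mem_unused hk)
  have hne : sgn (i (k + 1)) - thetaBar X i k (i (k + 1)).1 ≠ 0 := by
    intro h0
    rw [sub_eq_zero] at h0
    rw [← h0, abs_sgn] at hθi
    exact lt_irrefl _ hθi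
  have hL : lam = ⟪knotDir X i (k + 1), y⟫ :=
    mul_right_cancel₀ hne (hA.symm.trans (corr_eq_knotDir hθi))
  have htrans := corr_add_thetaBar_succ X i (hirr.isUnit_det hk.le) (hirr.isUnit_det hk) hA
  have hidx : ∀ l ∈ Set.Icc 1 (k + 1), (state X y k).idx l = i l := by
    intro l hl
    rcases Nat.lt_or_ge k l with hkl | hkl
    · obtain rfl : l = k + 1 := le_antisymm hl.2 hkl
      rw [h.var, hi]
    · exact h.idx l ⟨hl.1, hkl⟩
  have hsub : unused i (k + 1) ⊆ unused i k := fun j hj => LAR.mem_unused.2 fun l hl =>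
    LAR.mem_unused.1 hj l ⟨hl.1, hl.2.trans (Nat.le_succ k)⟩
  have hle : ∀ j ∈ unused i (k + 1), hit (corr X i (k + 1) y j) (thetaBar X i (k + 1) j) ≤ lam := by
    intro j hj
    rw [← abs_add_mul_le_iff (hθ' j hj), ← htrans]
    exact (nextKnot_spec (y := y) hkp hθ).2 j (hsub hj)
  obtain ⟨⟨j₀, hj₀, hj₀'⟩, hle₀⟩ :=
    nextKnot_spec (y := y) (k := k + 1) (by omega : k + 1 < p) hθ'
  have hres : ∀ β j, residAt X (k + 1) (state X y k) β j =
      corr X i (k + 1) y j + β * thetaBar X i (k + 1) j := by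
    intro β j
    rw [residAt, h.resid, h.knot, ← hlam, htrans, thetaBar_congr X hidx]
    ring
  have hin : inactive (k + 1) (state X y k) = unused i (k + 1) := unused_congr hidx
  have hset : {β : ℝ | 0 < β ∧ β ≤ (state X y k).knot ∧ ∃ j ∈ inactive (k + 1) (state X y k),
      |residAt X (k + 1) (state X y k) β j| = β} =
      {β : ℝ | 0 < β ∧ ∃ j ∈ unused i (k + 1),
        hit (corr X i (k + 1) y j) (thetaBar X i (k + 1) j) = β} := by
    ext β
    simp only [hres, hin, Set.mem_ofPred_eq, h.knot]
    constructor
    · rintro ⟨h1, -, j, hj, hj'⟩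
      exact ⟨h1, j, hj, (abs_add_mul_eq_iff (hθ' j hj) _).1 hj'⟩
    · rintro ⟨h1, j, hj, hj'⟩
      exact ⟨h1, hj' ▸ hle j hj, j, hj, (abs_add_mul_eq_iff (hθ' j hj) _).2 hj'⟩
  have hmax : ∀ j ∈ unused i (k + 1), hit (corr X i (k + 1) y j) (thetaBar X i (k + 1) j) ≤
      nextKnot X i (k + 1) y := fun j hj => (abs_add_mul_le_iff (hθ' j hj) _).1 (hle₀ j hj)
  have hsup : sSup {β : ℝ | 0 < β ∧ β ≤ (state X y k).knot ∧
      ∃ j ∈ inactive (k + 1) (state X y k), |residAt X (k + 1) (state X y k) β j| = β} =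
      nextKnot X i (k + 1) y := by
    rw [hset]
    rcases (nextKnot_nonneg (y := y) (by omega : k + 1 < p) hθ').eq_or_lt with h0 | h0
    · -- all levels vanish, and the supremum of the empty set is `0`
      rw [← h0]
      convert Real.sSup_empty
      ext β
      simp only [Set.mem_ofPred_eq, Set.mem_empty_iff_false, iff_false]
      rintro ⟨h1, j, hj, hj'⟩
      have := hmax j hj
      linarith
    · refine IsGreatest.csSup_eq ⟨⟨h0, j₀, hj₀, hj₀'⟩, ?_⟩
      rintro β ⟨-, j, hj, rfl⟩
      exact hmax j hj
  refine ⟨hL, ⟨?_, ?_, ?_, ?_⟩, hj₀' ▸ hle j₀ hj₀⟩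
  · intro l hl
    rw [← hidx l hl]
    exact Function.update_of_ne (by have := hl.2; omega) _ _
  · change (nextStep X (k + 1) (state X y k)).idx (k + 1 + 1) = _
    simp only [nextStep, Function.update_self, hsup]
    simp only [hin, hres, nextVar]
  · change (nextStep X (k + 1) (state X y k)).knot = _
    simp only [nextStep, hsup]
  · intro j
    change (nextStep X (k + 1) (state X y k)).resid j = _
    simp only [nextStep, hsup]
    rw [hres]

/-- The sequence made of the linear forms of the first `K` knots and of the next knot at `K + 1`
(and everywhere else, where its value is irrelevant). -/
def pathVec (X : Matrix (Fin n) (Fin p) ℝ) (i : ℕ → SignedVar p) (K : ℕ)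
    (y : EuclideanSpace ℝ (Fin n)) : ℕ → ℝ :=
  Function.updateFinset (fun _ => nextKnot X i K y) (Finset.Icc 1 K)
    fun k => ⟪knotDir X i k, y⟫

lemma pathVec_of_mem (hk : k ∈ Set.Icc 1 K) : pathVec X i K y k = ⟪knotDir X i k, y⟫ := by
  have : k ∈ Finset.Icc 1 K := by simpa using hk
  simp only [pathVec, Function.updateFinset, dif_pos this]

lemma pathVec_last : pathVec X i K y (K + 1) = nextKnot X i K y := by
  simp [pathVec, Function.updateFinset]

lemma follows_of_index (hirr : IrrCheck X i K) (hKp : K < p)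
    (h : ∀ k ∈ Set.Icc 1 K, index X y k = i k) (hk : k ≤ K) : Follows X i y k := by
  induction k with
  | zero => exact follows_zero
  | succ k ih =>
    have hf := ih (by omega)
    exact (hf.succ hirr hk hKp (by rw [← hf.index_eq]; exact h _ ⟨by omega, hk⟩)).2.1

/-- If the first `K` variables of the path are those of the sequence, then the first `K + 1` knots
are the entries of `pathVec`, and these do not increase. -/
lemma knot_eq_pathVec (hirr : IrrCheck X i K) (hKp : K < p)
    (h : ∀ k ∈ Set.Icc 1 K, index X y k = i k) :
    (∀ k ∈ Set.Icc 1 (K + 1), LAR.knot X y k = pathVec X i K y k) ∧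
      pathVec X i K y ∈ decr 0 (K + 1) := by
  have hstep : ∀ k, k < K → nextKnot X i k y = ⟪knotDir X i (k + 1), y⟫ ∧
      nextKnot X i (k + 1) y ≤ nextKnot X i k y := fun k hk => by
    have hf := follows_of_index hirr hKp h hk.le
    have := hf.succ hirr hk hKp (by rw [← hf.index_eq]; exact h _ ⟨by omega, hk⟩)
    exact ⟨this.1, this.2.2⟩
  have hval : ∀ k, k ≤ K → pathVec X i K y (k + 1) = nextKnot X i k y := fun k hk => by
    rcases hk.eq_or_lt with rfl | hk
    · exact pathVec_last
    · rw [pathVec_of_mem ⟨by omega, hk⟩, (hstep k hk).1]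
  refine ⟨fun k hk => ?_, fun k hk => ?_⟩
  · obtain ⟨q, rfl⟩ : ∃ q, k = q + 1 := ⟨k - 1, by have := hk.1; omega⟩
    have hq : q ≤ K := by have := hk.2; omega
    rw [hval q hq, (follows_of_index hirr hKp h hq).knot_eq]
  · rcases Nat.eq_zero_or_pos k with rfl | hk0
    · exact le_top
    · obtain ⟨q, rfl⟩ : ∃ q, k = q + 1 := ⟨k - 1, by omega⟩
      have hq : q < K := by have := hk.2; omega
      rw [knotSeq_of_pos (by omega), knotSeq_of_pos (by omega), hval q hq.le, hval (q + 1) hq]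
      exact_mod_cast (hstep q hq).2

/-- Conversely, when the entries of `pathVec` strictly decrease, the path follows the sequence. The
Irrepresentable Check makes a residual correlation that is below the current level at some knot
stay below it at all earlier knots. -/
lemma index_eq_of_pathVec (hirr : IrrCheck X i K) (hKp : K < p)
    (h : ∀ k ∈ Set.Icc 1 K, pathVec X i K y (k + 1) < pathVec X i K y k) :
    ∀ k ∈ Set.Icc 1 K, index X y k = i k := by
  set L : ℕ → ℝ := fun k => ⟪knotDir X i k, y⟫ with hL
  have hA : ∀ k, k < K → corr X i k y (i (k + 1)).1 =
      L (k + 1) * (sgn (i (k + 1)) - thetaBar X i k (i (k + 1)).1) := fun k hk =>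
    corr_eq_knotDir (hirr.abs_thetaBar_lt hk.le (hirr.mem_unused hk))
  have htrans : ∀ k, k < K → ∀ j, corr X i k y j + L (k + 1) * thetaBar X i k j =
      corr X i (k + 1) y j + L (k + 1) * thetaBar X i (k + 1) j := fun k hk =>
    corr_add_thetaBar_succ X i (hirr.isUnit_det hk.le) (hirr.isUnit_det hk) (hA k hk)
  have hlast : ∀ k, k < K → ∀ j ∈ unused i k, j ≠ (i (k + 1)).1 → j ∈ unused i (k + 1) := by
    intro k _ j hj hne
    refine LAR.mem_unused.2 fun l hl => ?_
    rcases Nat.lt_or_ge k l with hkl | hkl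
    · obtain rfl : l = k + 1 := le_antisymm hl.2 hkl
      exact hne.symm
    · exact LAR.mem_unused.1 hj l ⟨hl.1, hkl⟩
  -- descending induction on `k`: past the `k`-th knot, all unused variables stay below the diagonal
  have hC : ∀ d k, k + d = K → 1 ≤ k → ∀ j ∈ unused i k,
      |corr X i k y j + L k * thetaBar X i k j| < L k := by
    intro d
    induction d with
    | zero =>
      intro k hk hk1 j hj
      obtain rfl : k = K := by omega
      have hθ : ∀ j ∈ unused i k, |thetaBar X i k j| < 1 := fun j hj =>
        hirr.abs_thetaBar_lt le_rfl hj
      have h1 := h k ⟨hk1, le_rfl⟩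
      rw [pathVec_last, pathVec_of_mem ⟨hk1, le_rfl⟩] at h1
      rw [abs_add_mul_lt_iff (hθ j hj)]
      exact ((abs_add_mul_le_iff (hθ j hj) _).1 ((nextKnot_spec hKp hθ).2 j hj)).trans_lt h1
    | succ d ih =>
      intro k hk hk1 j hj
      have hkK : k < K := by omega
      have hθ := hirr.abs_thetaBar_lt hkK.le hj
      have h1 := h k ⟨hk1, hkK.le⟩
      rw [pathVec_of_mem ⟨by omega, hkK⟩, pathVec_of_mem ⟨hk1, hkK.le⟩] at h1
      rw [abs_add_mul_lt_iff hθ]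
      refine lt_of_le_of_lt ?_ h1
      rw [← abs_add_mul_le_iff hθ]
      have hC' := ih (k + 1) (by omega) (by omega)
      by_cases hj' : j = (i (k + 1)).1
      · obtain ⟨j₀, hj₀⟩ := unused_nonempty i (k := k + 1) (by omega : k + 1 < p)
        have hpos : 0 < L (k + 1) := (abs_nonneg _).trans_lt (hC' j₀ hj₀)
        rw [hj', hA k hkK, show L (k + 1) * (sgn (i (k + 1)) - thetaBar X i k (i (k + 1)).1) +
          ⟪knotDir X i (k + 1), y⟫ * thetaBar X i k (i (k + 1)).1 = sgn (i (k + 1)) * L (k + 1) by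
            simp only [hL]; ring, abs_mul, abs_sgn, one_mul, abs_of_pos hpos]
      · have := hC' j (hlast k hkK j hj hj')
        rw [← htrans k hkK] at this
        exact this.le
  have hnext : ∀ k, k < K → nextVar X i k y = i (k + 1) := fun k hk => by
    have hC' := hC (K - (k + 1)) (k + 1) (by omega) (by omega)
    obtain ⟨j₀, hj₀⟩ := unused_nonempty i (k := k + 1) (by omega : k + 1 < p)
    refine (nextVar_eq (lam := L (k + 1)) (by omega : k < p)
      (fun j hj => hirr.abs_thetaBar_lt hk.le hj) (hirr.mem_unused hk)
      ((abs_nonneg _).trans_lt (hC' j₀ hj₀)) ?_ fun j hj hne => ?_).2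
    · rw [hA k hk]; ring
    · rw [htrans k hk]
      exact hC' j (hlast k hk j hj hne)
  have hF : ∀ k, k ≤ K → Follows X i y k := fun k => by
    induction k with
    | zero => exact fun _ => follows_zero
    | succ k ih => exact fun hk => ((ih (by omega)).succ hirr hk hKp (hnext k hk)).2.1
  intro k hk
  obtain ⟨q, rfl⟩ : ∃ q, k = q + 1 := ⟨k - 1, by have := hk.1; omega⟩
  have hq : q < K := hk.2
  rw [(hF q hq.le).index_eq, hnext q hq]

end Path

/-! ### Independence of the knots -/

section Isotropic

variable {n : ℕ}

/-- The Gaussian law with mean `c` and covariance matrix `σ² Id`. -/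
abbrev isoGaussian (c : EuclideanSpace ℝ (Fin n)) (σ : ℝ) : Measure (EuclideanSpace ℝ (Fin n)) :=
  multivariateGaussian c ((σ ^ 2) • (1 : Matrix (Fin n) (Fin n) ℝ))

lemma map_const_add_isoGaussian (c : EuclideanSpace ℝ (Fin n)) (σ : ℝ) :
    (isoGaussian (0 : EuclideanSpace ℝ (Fin n)) σ).map (fun y => c + y) = isoGaussian c σ := by
  unfold isoGaussian multivariateGaussian
  rw [Measure.map_map (by fun_prop) (by fun_prop)]
  congr 1
  ext1 y
  simp

variable (c : EuclideanSpace ℝ (Fin n)) (σ : ℝ)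

lemma cov_inner_isoGaussian (x z : EuclideanSpace ℝ (Fin n)) :
    cov[fun y => ⟪x, y⟫, fun y => ⟪z, y⟫; isoGaussian c σ] = σ ^ 2 * ⟪x, z⟫ := by
  have hS : ((σ ^ 2) • (1 : Matrix (Fin n) (Fin n) ℝ)).PosSemidef :=
    PosSemidef.one.smul (sq_nonneg σ)
  rw [← covarianceBilin_apply_eq_cov IsGaussian.memLp_two_id,
    covarianceBilin_multivariateGaussian hS, smul_mulVec, one_mulVec, dotProduct_smul, smul_eq_mul,
    EuclideanSpace.inner_eq_star_dotProduct]
  simp [dotProduct_comm]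

lemma map_inner_isoGaussian (w : EuclideanSpace ℝ (Fin n)) :
    (isoGaussian c σ).map (fun y => ⟪w, y⟫) =
      gaussianReal ⟪w, c⟫ (Real.toNNReal (σ ^ 2 * ‖w‖ ^ 2)) := by
  have h := IsGaussian.map_eq_gaussianReal (μ := isoGaussian c σ) (innerSL ℝ w)
  have h1 : ∫ y, innerSL ℝ w y ∂isoGaussian c σ = ⟪w, c⟫ := by
    rw [ContinuousLinearMap.integral_comp_id_comm IsGaussian.integrable_id,
      integral_id_multivariateGaussian]
    rfl
  have h2 : Var[innerSL ℝ w; isoGaussian c σ] = σ ^ 2 * ‖w‖ ^ 2 := by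
    rw [← covariance_self (by fun_prop), ← real_inner_self_eq_norm_sq, ← cov_inner_isoGaussian c σ]
    rfl
  rw [h1, h2] at h
  exact h

lemma isoGaussian_inner_eq_zero {σ : ℝ} (hσ : 0 < σ) {w : EuclideanSpace ℝ (Fin n)} (hw : w ≠ 0)
    (t : ℝ) : isoGaussian c σ {y | ⟪w, y⟫ = t} = 0 := by
  have h := map_inner_isoGaussian c σ w
  have hne : Real.toNNReal (σ ^ 2 * ‖w‖ ^ 2) ≠ 0 := by
    have : 0 < σ ^ 2 * ‖w‖ ^ 2 := by have := norm_pos_iff.2 hw; positivity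
    simpa using this
  have := nullSingletonClass_gaussianReal (μ := ⟪w, c⟫) hne
  have h1 : (isoGaussian c σ).map (fun y => ⟪w, y⟫) {t} = 0 := by rw [h]; exact measure_singleton t
  rwa [Measure.map_apply (by fun_prop) (measurableSet_singleton t)] at h1

/-- Inner products with pairwise orthogonal vectors of `U` and the projection on `Uᗮ` are
independent under an isotropic Gaussian law. -/
lemma map_inner_prod_starProjection (s : Finset ℕ) (w : ℕ → EuclideanSpace ℝ (Fin n))
    (U : Submodule ℝ (EuclideanSpace ℝ (Fin n))) (hU : ∀ k ∈ s, w k ∈ U)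
    (hw : ∀ k ∈ s, ∀ l ∈ s, k ≠ l → ⟪w k, w l⟫ = 0) :
    (isoGaussian c σ).map (fun y => ((fun k : s => ⟪w k, y⟫), Uᗮ.starProjection y)) =
      (Measure.pi fun k : s => gaussianReal ⟪w k, c⟫ (Real.toNNReal (σ ^ 2 * ‖w k‖ ^ 2))).prod
        ((isoGaussian c σ).map Uᗮ.starProjection) := by
  have hL : HasGaussianLaw (fun y : EuclideanSpace ℝ (Fin n) =>
      ((fun k : s => ⟪w k, y⟫), Uᗮ.starProjection y)) (isoGaussian c σ) :=
    (IsGaussian.hasGaussianLaw_id (μ := isoGaussian c σ)).map_fun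
      ((ContinuousLinearMap.pi fun k : s => innerSL ℝ (w k)).prod Uᗮ.starProjection)
  have hind : IndepFun (fun y : EuclideanSpace ℝ (Fin n) => fun k : s => ⟪w k, y⟫)
      (fun y => Uᗮ.starProjection y) (isoGaussian c σ) := by
    refine hL.indepFun_of_covariance_strongDual fun L₁ L₂ => ?_
    set z := (InnerProductSpace.toDual ℝ _).symm L₂ with hz
    have h1 : (L₁ ∘ fun y : EuclideanSpace ℝ (Fin n) => fun k : s => ⟪w k, y⟫) =
        fun y => ⟪∑ k : s, L₁ (Pi.single k 1) • w k, y⟫ := by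
      ext y
      rw [Function.comp_apply, sum_inner]
      conv_lhs => rw [pi_eq_sum_univ' (fun k : s => ⟪w k, y⟫), map_sum]
      refine Finset.sum_congr rfl fun k _ => ?_
      rw [map_smul, smul_eq_mul, real_inner_smul_left, mul_comm]
    have h2 : (L₂ ∘ fun y => Uᗮ.starProjection y) = fun y => ⟪Uᗮ.starProjection z, y⟫ := by
      ext y
      rw [Function.comp_apply, Submodule.inner_starProjection_left_eq_right, hz,
        InnerProductSpace.toDual_symm_apply]
    rw [h1, h2, cov_inner_isoGaussian, mul_eq_zero]
    right
    rw [sum_inner]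
    refine Finset.sum_eq_zero fun k _ => ?_
    rw [real_inner_smul_left,
      (Submodule.mem_orthogonal _ _).1 (Submodule.starProjection_apply_mem Uᗮ z) _ (hU k k.2),
      mul_zero]
  have hpi : iIndepFun (fun (k : s) (y : EuclideanSpace ℝ (Fin n)) => ⟪w k, y⟫)
      (isoGaussian c σ) := by
    refine HasGaussianLaw.iIndepFun_of_covariance_eq_zero hL.fst fun k l hkl => ?_
    rw [cov_inner_isoGaussian, hw k k.2 l l.2 fun h => hkl (Subtype.ext h), mul_zero]
  have hm : ∀ k : s, AEMeasurable (fun y : EuclideanSpace ℝ (Fin n) => ⟪w k, y⟫)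
      (isoGaussian c σ) := fun k => by fun_prop
  rw [(indepFun_iff_map_prod_eq_prod_map_map hL.fst.aemeasurable hL.snd.aemeasurable).1 hind,
    (iIndepFun_iff_map_fun_eq_pi_map hm).1 hpi]
  simp_rw [map_inner_isoGaussian]

end Isotropic

/-! ### Measurability of the path along a sequence -/

section Measurability

variable {n p : ℕ} {α : Type*} [MeasurableSpace α]

lemma measurable_apply_index {f : α → Fin p → ℝ} (hf : ∀ j, Measurable fun a => f a j)
    {J : α → Fin p} (hJ : Measurable J) : Measurable fun a => f a (J a) := by
  have : (fun a => f a (J a)) = fun a => ∑ j, if J a = j then f a j else 0 := by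
    ext a; simp
  rw [this]
  exact Finset.measurable_sum _ fun j _ =>
    Measurable.ite (hJ (measurableSet_singleton j)) (hf j) measurable_const

lemma measurable_corr (X : Matrix (Fin n) (Fin p) ℝ) (i : ℕ → SignedVar p) (k : ℕ) (j : Fin p) :
    Measurable fun y => corr X i k y j := by
  unfold corr
  fun_prop

variable [NeZero p]

lemma argmaxOn_eq_iff {s : Finset (Fin p)} (hs : s.Nonempty) (f : Fin p → ℝ) (j : Fin p) :
    argmaxOn s f = j ↔ (j ∈ s ∧ ∀ l ∈ s, f l ≤ f j) ∧
      ∀ q ∈ s, (∀ l ∈ s, f l ≤ f q) → j ≤ q := by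
  have h : (s.filter fun j => ∀ l ∈ s, f l ≤ f j).Nonempty :=
    ⟨_, Finset.mem_filter.2 (argmaxOn_spec hs f)⟩
  rw [argmaxOn, dif_pos h, Finset.min'_eq_iff]
  simp only [Finset.mem_filter, and_imp]

lemma measurable_argmaxOn (s : Finset (Fin p)) {f : α → Fin p → ℝ}
    (hf : ∀ j, Measurable fun a => f a j) : Measurable fun a => argmaxOn s (f a) := by
  rcases s.eq_empty_or_nonempty with rfl | hs
  · simp [argmaxOn]
  refine measurable_to_countable' fun j => ?_
  have : (fun a => argmaxOn s (f a)) ⁻¹' {j} = {a | (j ∈ s ∧ ∀ l ∈ s, f a l ≤ f a j) ∧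
      ∀ q ∈ s, (∀ l ∈ s, f a l ≤ f a q) → j ≤ q} := by
    ext a; exact argmaxOn_eq_iff hs (f a) j
  rw [this]
  have hle : ∀ q l, MeasurableSet {a | f a l ≤ f a q} := fun q l => measurableSet_le (hf l) (hf q)
  have hmax : ∀ q, Measurable fun a => ∀ l ∈ s, f a l ≤ f a q := fun q =>
    Measurable.forall fun l => Measurable.imp measurable_const (measurableSet_setOfPred.1 (hle q l))
  exact measurableSet_setOfPred.2 ((measurable_const.and (hmax j)).and
    (Measurable.forall fun q => measurable_const.imp ((hmax q).imp measurable_const)))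

variable (X : Matrix (Fin n) (Fin p) ℝ) (i : ℕ → SignedVar p) (k : ℕ)

lemma measurable_nextKnot : Measurable (nextKnot X i k) := by
  have h : ∀ j, Measurable fun y => hit (corr X i k y j) (thetaBar X i k j) := fun j => by
    have := measurable_corr X i k j
    unfold hit
    fun_prop
  exact measurable_apply_index h (measurable_argmaxOn _ h)

lemma measurableSet_nextVar_eq (v : SignedVar p) : MeasurableSet {y | nextVar X i k y = v} := by
  have h : ∀ j, Measurable fun y => corr X i k y j + nextKnot X i k y * thetaBar X i k j :=
    fun j => (measurable_corr X i k j).add ((measurable_nextKnot X i k).mul_const _)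
  have hJ := measurable_argmaxOn (unused i k) fun j => (h j).abs
  have hN := measurable_apply_index h hJ
  have hs : ∀ u : ℤˣ, MeasurableSet {x : ℝ | signOf x = u} := fun u => by
    have : {x : ℝ | signOf x = u} = {x | (0 ≤ x → 1 = u) ∧ (¬ 0 ≤ x → -1 = u)} := by
      ext x; simp only [signOf, Set.mem_ofPred_eq]; split_ifs with h <;> simp [h]
    rw [this]
    have h0 : Measurable fun x : ℝ => 0 ≤ x := measurableSet_setOfPred.1 measurableSet_Ici
    exact measurableSet_setOfPred.2 ((h0.imp measurable_const).and (h0.not.imp measurable_const))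
  have : {y | nextVar X i k y = v} = {y | (nextVar X i k y).1 = v.1} ∩
      {y | (nextVar X i k y).2 = v.2} := by
    ext y; exact Prod.ext_iff
  rw [this]
  exact (hJ (measurableSet_singleton v.1)).inter (hN (hs v.2))

lemma measurable_pathVec : Measurable (pathVec X i k) := by
  refine measurable_pi_iff.2 fun l => ?_
  unfold pathVec Function.updateFinset
  split_ifs
  · fun_prop
  · exact measurable_nextKnot X i k

end Measurability

/-! ### The conditional law of the p-value along a sequence -/

section Sequence

variable {n p : ℕ} (X : Matrix (Fin n) (Fin p) ℝ)

variable {X} in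
lemma IrrCheck.congr {i i' : ℕ → SignedVar p} {K : ℕ} (hirr : IrrCheck X i K)
    (h : ∀ k ∈ Set.Icc 1 K, i k = i' k) : IrrCheck X i' K := by
  refine ⟨hirr.1.congr fun l hl => by simp only [h l hl], fun k hk => ?_⟩
  have hk' : ∀ l ∈ Set.Icc 1 k, i l = i' l := fun l hl => h l ⟨hl.1, hl.2.trans hk.2⟩
  obtain ⟨h1, h2⟩ := hirr.2 k hk
  rw [thetaBar_congr X hk'] at h2
  constructor
  · have h' : ∀ l : Fin k, i (l + 1) = i' (l + 1) := fun l => hk' _ ⟨by omega, by omega⟩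
    simpa only [gram, h'] using h1
  · exact fun j hj => h2 j fun l hl => by rw [hk' l hl]; exact hj l hl

lemma E1_congr {i i' : ℕ → SignedVar p} {k : ℕ} (h : ∀ l ∈ Set.Icc 1 k, i l = i' l) (n₁ : ℕ) :
    E1 X i k n₁ = E1 X i' k n₁ := by
  have : projV X i k = projV X i' k := by
    funext ℓ
    simp only [projV, colSpan_congr X h]
  rw [E1, E1, this]

lemma E1_le (i : ℕ → SignedVar p) (k n₁ : ℕ) : E1 X i k n₁ ≤ (colSpan X i k)ᗮ := by
  rintro _ ⟨v, -, rfl⟩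
  exact Submodule.starProjection_apply_mem _ _

/-- The projection on `E₁` only depends on the part of `y` orthogonal to the first columns. -/
lemma starProjection_E1 {i i' : ℕ → SignedVar p} {k : ℕ} (h : ∀ l ∈ Set.Icc 1 k, i l = i' l)
    (n₁ : ℕ) (y : EuclideanSpace ℝ (Fin n)) :
    (E1 X i' (k + 1) n₁).starProjection ((colSpan X i k)ᗮ.starProjection y) =
      (E1 X i' (k + 1) n₁).starProjection y := by
  have h1 : (colSpan X i k).starProjection y ∈ (E1 X i' (k + 1) n₁)ᗮ := by
    have h2 : colSpan X i k ≤ (E1 X i' (k + 1) n₁)ᗮ := by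
      rw [colSpan_congr X h]
      exact (colSpan_mono X i' (Nat.le_succ k)).trans
        ((Submodule.le_orthogonal_orthogonal _).trans (Submodule.orthogonal_le (E1_le X i' _ _)))
    exact h2 (Submodule.starProjection_apply_mem _ _)
  rw [Submodule.starProjection_orthogonal_val, map_sub,
    (Submodule.starProjection_apply_eq_zero_iff _).2 h1, sub_zero]

variable (i : ℕ → SignedVar p)

lemma corr_starProjection (k : ℕ) (y : EuclideanSpace ℝ (Fin n)) :
    corr X i k ((colSpan X i k)ᗮ.starProjection y) = corr X i k y := by
  funext j
  rw [corr, corr, Submodule.starProjection_eq_self_iff.2 (Submodule.starProjection_apply_mem _ _)]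

lemma knotDir_mem {k : ℕ} (hk : 1 ≤ k) : knotDir X i k ∈ colSpan X i k := by
  refine Submodule.smul_mem _ _ ?_
  rw [Submodule.starProjection_orthogonal_val]
  exact Submodule.sub_mem _ (col_mem_colSpan X i ⟨hk, le_rfl⟩)
    (colSpan_mono X i (Nat.sub_le k 1) (Submodule.starProjection_apply_mem _ _))

lemma inner_knotDir_eq_zero {k : ℕ} {z : EuclideanSpace ℝ (Fin n)} (hz : z ∈ colSpan X i (k - 1)) :
    ⟪knotDir X i k, z⟫ = 0 := by
  rw [knotDir, real_inner_smul_left, real_inner_comm,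
    (Submodule.mem_orthogonal _ _).1 (Submodule.starProjection_apply_mem _ _) _ hz, mul_zero]

lemma inner_knotDir_knotDir {k l : ℕ} (hk : 1 ≤ k) (hl : 1 ≤ l) (h : k ≠ l) :
    ⟪knotDir X i k, knotDir X i l⟫ = 0 := by
  rcases lt_or_gt_of_ne h with h | h
  · rw [real_inner_comm]
    exact inner_knotDir_eq_zero X i (colSpan_mono X i (by omega) (knotDir_mem X i hk))
  · exact inner_knotDir_eq_zero X i (colSpan_mono X i (by omega) (knotDir_mem X i hl))

variable {X i} {K : ℕ}

lemma knotDir_ne_zero (hirr : IrrCheck X i K) {k : ℕ} (hk : k < K) : knotDir X i (k + 1) ≠ 0 := by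
  have h := one_sub_sgn_mul_pos (i (k + 1)) (hirr.abs_thetaBar_lt hk.le (hirr.mem_unused hk))
  refine smul_ne_zero (div_ne_zero ?_ h.ne') (starProjection_col_ne_zero X i (hirr.isUnit_det hk))
  intro h0
  simpa [h0] using abs_sgn (i (k + 1))

/-- `ρ_k` is the norm of the vector defining the `k`-th knot. -/
lemma rho_eq_norm (hirr : IrrCheck X i K) {k : ℕ} (hk : k < K) :
    rho X i (k + 1) = ‖knotDir X i (k + 1)‖ := by
  have h := one_sub_sgn_mul_pos (i (k + 1)) (hirr.abs_thetaBar_lt hk.le (hirr.mem_unused hk))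
  rw [rho_succ X i (hirr.isUnit_det hk.le)]
  refine Eq.trans ?_ (norm_smul _ _).symm
  rw [Real.norm_eq_abs, abs_div, abs_sgn]
  change _ = 1 / |1 - sgn (i (k + 1)) * thetaBar X i k (i (k + 1)).1| *
    ‖(colSpan X i k)ᗮ.starProjection (col X (i (k + 1)).1)‖
  rw [abs_of_pos h]
  ring

lemma Fabc_congr {v : ℕ → ℝ} {lam lam' : ℕ → EReal} {a b c : ℕ} (ha : lam a = lam' a)
    (hc : lam c = lam' c) (t : EReal) : Fabc v lam a b c t = Fabc v lam' a b c t := by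
  simp only [Fabc, ha, hc]

/-- The law of the linear form that gives the `k`-th knot, when the observation has mean `μ₀` and
covariance matrix `σ² Id`. -/
def knotLaw (X : Matrix (Fin n) (Fin p) ℝ) (i : ℕ → SignedVar p) (μ₀ : EuclideanSpace ℝ (Fin n))
    (σ : ℝ) (k : ℕ) : Measure ℝ :=
  gaussianReal ⟪knotDir X i k, μ₀⟫ (Real.toNNReal (σ ^ 2 * ‖knotDir X i k‖ ^ 2))

instance (μ₀ : EuclideanSpace ℝ (Fin n)) (σ : ℝ) (k : ℕ) :
    IsProbabilityMeasure (knotLaw X i μ₀ σ k) := by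
  unfold knotLaw; infer_instance

variable {μ₀ : EuclideanSpace ℝ (Fin n)} {σ : ℝ} {a b c : ℕ}

/-- Under the null hypothesis, the linear forms past the `a`-th knot are centered. -/
lemma knotLaw_eq_gauss (hirr : IrrCheck X i K) (hμ : μ₀ ∈ colSpan X i a) {k : ℕ} (hak : a < k)
    (hkK : k ≤ K) : knotLaw X i μ₀ σ k = gauss (σ * rho X i k) := by
  obtain ⟨q, rfl⟩ : ∃ q, k = q + 1 := ⟨k - 1, by omega⟩
  rw [knotLaw, inner_knotDir_eq_zero X i (colSpan_mono X i (by omega) hμ), gauss, mul_pow,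
    rho_eq_norm hirr hkK]

variable (X) in
/-- This is where `K < rank X` enters: the next knot does not vanish identically. -/
lemma exists_col_notMem (i : ℕ → SignedVar p) (hKr : K < X.rank) :
    ∃ j, col X j ∉ colSpan X i K := by
  by_contra! hall
  have h1 : X.rank ≤ Module.finrank ℝ (colSpan X i K) := by
    rw [Matrix.rank_eq_finrank_span_cols]
    have h2 : (Submodule.span ℝ (Set.range X.col)).map
        (WithLp.linearEquiv 2 ℝ (Fin n → ℝ)).symm.toLinearMap ≤ colSpan X i K := by
      rw [Submodule.map_span, Submodule.span_le]
      rintro _ ⟨_, ⟨j, rfl⟩, rfl⟩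
      exact hall j
    have h3 := Submodule.finrank_mono h2
    rwa [LinearEquiv.finrank_map_eq] at h3
  have h2 : Module.finrank ℝ (colSpan X i K) ≤ K := by
    have h3 : colSpan X i K = Submodule.span ℝ
        (((Finset.Icc 1 K).image fun l => col X (i l).1 : Finset _) : Set _) := by
      simp [colSpan]
    rw [h3]
    refine (finrank_span_finset_le_card _).trans (Finset.card_image_le.trans ?_)
    simp
  omega

variable [NeZero p] {y : EuclideanSpace ℝ (Fin n)}

variable (X i) in
lemma nextKnot_starProjection (k : ℕ) (y : EuclideanSpace ℝ (Fin n)) :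
    nextKnot X i k ((colSpan X i k)ᗮ.starProjection y) = nextKnot X i k y := by
  simp only [nextKnot, corr_starProjection]

variable (X i) in
lemma nextVar_starProjection (k : ℕ) (y : EuclideanSpace ℝ (Fin n)) :
    nextVar X i k ((colSpan X i k)ᗮ.starProjection y) = nextVar X i k y := by
  simp only [nextVar, nextKnot_starProjection, corr_starProjection]

/-- The signed variables of the path, when its first `K` variables are those of the sequence. -/
lemma index_eq_update (hirr : IrrCheck X i K) (hKp : K < p)
    (h : ∀ k ∈ Set.Icc 1 K, index X y k = i k) :
    ∀ k ∈ Set.Icc 1 (K + 1),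
      index X y k = Function.update i (K + 1) (nextVar X i K y) k := by
  intro k hk
  rcases hk.2.eq_or_lt with rfl | hlt
  · rw [Function.update_self, (follows_of_index hirr hKp h le_rfl).index_eq]
  · rw [Function.update_of_ne hlt.ne, h k ⟨hk.1, by omega⟩]

/-- All the standard deviations `ρ_k`, `k ≤ K + 1`, are positive along the path. For `k = K + 1`
this needs a positive last knot, since the last variable could have a column in the span of the
others. -/
lemma rho_index_pos (hirr : IrrCheck X i K) (hKp : K < p)
    (h : ∀ k ∈ Set.Icc 1 K, index X y k = i k) (h0 : 0 < nextKnot X i K y) {k : ℕ}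
    (hk : k ≤ K + 1) : 0 < rho X (index X y) k := by
  have hirr' := hirr.congr fun k hk => (h k hk).symm
  cases k with
  | zero => exact one_pos
  | succ k =>
    rcases (Nat.le_of_succ_le_succ hk).lt_or_eq with hlt | rfl
    · rw [rho_eq_norm hirr' hlt]
      exact norm_pos_iff.2 (knotDir_ne_zero hirr' hlt)
    · have hθ : ∀ j ∈ unused i k, |thetaBar X i k j| < 1 := fun j hj =>
        hirr.abs_thetaBar_lt le_rfl hj
      have hv := (follows_of_index hirr hKp h le_rfl).index_eq
      obtain ⟨hmem, hs⟩ := nextVar_spec (y := y) hKp hθ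
      have hpos := one_sub_sgn_mul_pos (nextVar X i k y) (hθ _ hmem)
      rw [rho_succ X _ (hirr'.isUnit_det le_rfl), hv, thetaBar_congr X h]
      refine div_pos (norm_pos_iff.2 fun hd => ?_) hpos
      have hA : corr X i k y (nextVar X i k y).1 = 0 := by
        have h1 : (colSpan X i k)ᗮ.starProjection (col X (nextVar X i k y).1) = 0 := by
          simpa only [colSpan_congr X h] using hd
        rw [corr_eq_inner, h1, inner_zero_left]
      rw [hA, zero_add] at hs
      have : nextKnot X i k y *
        (1 - sgn (nextVar X i k y) * thetaBar X i k (nextVar X i k y).1) = 0 := by linarith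
      exact (mul_pos h0 hpos).ne' this

/-- The p-value is the conditional tail probability of the `b`-th knot given the knots `a`
and `c`. -/
lemma alphaHat_eq_tailProb (hirr : IrrCheck X i K) (hKp : K < p) (hσ : 0 < σ)
    (hμ : μ₀ ∈ colSpan X i a) (hab : a < b) (hbc : b < c) (hcK : c ≤ K + 1)
    (h : ∀ k ∈ Set.Icc 1 K, index X y k = i k) (h0 : 0 < nextKnot X i K y) :
    alphaHat X σ a b c y = tailProb (knotLaw X i μ₀ σ) a b c (pathVec X i K y) := by
  obtain ⟨hknot, hdecr⟩ := knot_eq_pathVec hirr hKp h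
  have hE : ∀ k, k ≤ K + 1 → knotE X y k = knotSeq (pathVec X i K y) k := fun k hk => by
    cases k with
    | zero => rfl
    | succ k => rw [knotE, knotSeq, hknot (k + 1) ⟨by omega, hk⟩]
  have hle : ∀ k l, k ≤ l → l ≤ K + 1 →
      knotSeq (pathVec X i K y) l ≤ knotSeq (pathVec X i K y) k := fun k l hkl hl =>
    decr_le hkl fun q hq => hdecr q ⟨by omega, by have := hq.2; omega⟩
  rw [← one_sub_Fabc_div_Fabc (knotLaw X i μ₀ σ) (v := fun k => σ * rho X (index X y) k) hab hbc
    (pathVec X i K y) (fun k hk => ?_) (fun k hk => ?_) (hle _ _ hbc.le hcK)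
    (hle _ _ hab.le (by omega))]
  · unfold alphaHat
    simp only
    rw [hE b (by omega), hE a (by omega), Fabc_congr (hE a (by omega)) (hE c hcK),
      Fabc_congr (hE a (by omega)) (hE c hcK)]
  · exact mul_pos hσ (rho_index_pos hirr hKp h h0 (by have := hk.2; omega))
  · have hkK : k ≤ K := by have := hk.2; omega
    rw [knotLaw_eq_gauss hirr hμ hk.1 hkK,
      rho_congr X fun l hl => h l ⟨hl.1, hl.2.trans hkK⟩]

/-- Almost surely, no two consecutive knots of the sequence are equal and the last one is
positive. -/
lemma ae_pathVec (hirr : IrrCheck X i K) (hKr : K < X.rank) (hKp : K < p) (hσ : 0 < σ) :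
    ∀ᵐ y ∂isoGaussian μ₀ σ, (∀ k ∈ Set.Icc 1 K, pathVec X i K y (k + 1) ≠ pathVec X i K y k) ∧
      0 < nextKnot X i K y := by
  have hnull : ∀ {w : EuclideanSpace ℝ (Fin n)}, w ≠ 0 → ∀ᵐ y ∂isoGaussian μ₀ σ, ⟪w, y⟫ ≠ 0 :=
    fun {w} hw => by
      rw [ae_iff]
      simpa using isoGaussian_inner_eq_zero μ₀ hσ hw 0
  have hθ : ∀ j ∈ unused i K, |thetaBar X i K j| < 1 := fun j hj => hirr.abs_thetaBar_lt le_rfl hj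
  have hindep : ∀ k, 1 ≤ k → k ≤ K → ∀ z, ⟪knotDir X i k, z⟫ = 0 → knotDir X i k - z ≠ 0 := by
    intro k hk hkK z hz h0
    obtain ⟨q, rfl⟩ : ∃ q, k = q + 1 := ⟨k - 1, by omega⟩
    refine knotDir_ne_zero hirr hkK ?_
    rw [← sub_eq_zero.1 h0, inner_self_eq_zero] at hz
    exact hz
  have h1 : ∀ k ∈ Set.Ico 1 K, ∀ᵐ y ∂isoGaussian μ₀ σ,
      pathVec X i K y (k + 1) ≠ pathVec X i K y k := by
    intro k hk
    have hne := hindep k hk.1 hk.2.le (knotDir X i (k + 1))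
      (inner_knotDir_knotDir X i hk.1 (by omega) (by omega))
    filter_upwards [hnull hne] with y hy heq
    rw [pathVec_of_mem ⟨by omega, hk.2⟩, pathVec_of_mem ⟨hk.1, hk.2.le⟩] at heq
    rw [inner_sub_left, heq, sub_self] at hy
    exact hy rfl
  -- the next knot is one of finitely many linear forms orthogonal to the previous knots
  have h2 : ∀ᵐ y ∂isoGaussian μ₀ σ, ∀ j : Fin p, ∀ r ∈ ({1 / (1 - thetaBar X i K j),
      -1 / (1 + thetaBar X i K j)} : Finset ℝ), 1 ≤ K →
      ⟪knotDir X i K - r • (colSpan X i K)ᗮ.starProjection (col X j), y⟫ ≠ 0 := by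
    rw [ae_all_iff]
    intro j
    rw [Finset.eventually_all]
    intro r _
    by_cases hK : 1 ≤ K
    · have hne := hindep K hK le_rfl (r • (colSpan X i K)ᗮ.starProjection (col X j)) (by
        rw [real_inner_smul_right, (Submodule.mem_orthogonal _ _).1
          (Submodule.starProjection_apply_mem _ _) _ (knotDir_mem X i hK), mul_zero])
      filter_upwards [hnull hne] with y hy _ using hy
    · exact Filter.Eventually.of_forall fun y h => absurd h hK
  obtain ⟨j₁, hj₁⟩ := exists_col_notMem X i hKr
  have hne₁ : (colSpan X i K)ᗮ.starProjection (col X j₁) ≠ 0 := by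
    rw [Submodule.starProjection_orthogonal_val, sub_ne_zero]
    intro h
    apply hj₁
    rw [h]
    exact Submodule.starProjection_apply_mem _ _
  have hu₁ : j₁ ∈ unused i K := LAR.mem_unused.2 fun l hl h => hj₁ (h ▸ col_mem_colSpan X i hl)
  filter_upwards [(Filter.eventually_all_finite (Set.finite_Ico 1 K)).2 h1, h2, hnull hne₁]
    with y hy1 hy2 hy3
  obtain ⟨⟨j, hj, hj'⟩, hle⟩ := nextKnot_spec (y := y) hKp hθ
  constructor
  · intro k hk
    rcases hk.2.lt_or_eq with hlt | rfl
    · exact hy1 k ⟨hk.1, hlt⟩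
    intro heq
    rw [pathVec_last, pathVec_of_mem hk, ← hj', hit, corr_eq_inner] at heq
    rcases max_choice (⟪(colSpan X i k)ᗮ.starProjection (col X j), y⟫ / (1 - thetaBar X i k j))
      (-⟪(colSpan X i k)ᗮ.starProjection (col X j), y⟫ / (1 + thetaBar X i k j)) with h | h <;>
      rw [h] at heq
    · refine hy2 j (1 / (1 - thetaBar X i k j)) (by simp) hk.1 ?_
      rw [inner_sub_left, real_inner_smul_left, ← heq]; ring
    · refine hy2 j (-1 / (1 + thetaBar X i k j)) (by simp) hk.1 ?_
      rw [inner_sub_left, real_inner_smul_left, ← heq]; ring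
  · refine lt_of_le_of_ne (nextKnot_nonneg hKp hθ) fun h0 => hy3 ?_
    have := hle j₁ hu₁
    rw [← h0, zero_mul, add_zero, corr_eq_inner] at this
    exact abs_eq_zero.1 (le_antisymm this (abs_nonneg _))

end Sequence

lemma measurableSet_mem_of_countable {β ι : Type*} [MeasurableSpace β] [Countable ι] {f : β → ι}
    (hf : ∀ v, MeasurableSet {q | f q = v}) {D : ι → Set β} (hD : ∀ v, MeasurableSet (D v)) :
    MeasurableSet {q | q ∈ D (f q)} := by
  have : {q | q ∈ D (f q)} = ⋃ v, {q | f q = v} ∩ D v := by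
    ext q; simp
  rw [this]
  exact MeasurableSet.iUnion fun v => (hf v).inter (hD v)

section Sequence

variable {n p : ℕ} [NeZero p] {X : Matrix (Fin n) (Fin p) ℝ} {i : ℕ → SignedVar p} {K : ℕ}
  {μ₀ : EuclideanSpace ℝ (Fin n)} {σ : ℝ} {a b c : ℕ}

/-- Integration over the observation, as an integration over the independent linear forms of the
knots `1, …, K` and over the part of the observation orthogonal to the first `K` columns. -/
lemma lintegral_pathVec {F : (ℕ → ℝ) × EuclideanSpace ℝ (Fin n) → ℝ≥0∞} (hF : Measurable F) :
    ∫⁻ y, F (pathVec X i K y, (colSpan X i K)ᗮ.starProjection y) ∂isoGaussian μ₀ σ =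
      ∫⁻ w, (∫⋯∫⁻_Finset.Icc 1 K, (fun x => F (x, w)) ∂knotLaw X i μ₀ σ)
        (fun _ => nextKnot X i K w)
        ∂(isoGaussian μ₀ σ).map (colSpan X i K)ᗮ.starProjection := by
  set s := Finset.Icc 1 K with hs
  have hmem : ∀ k ∈ s, 1 ≤ k ∧ k ≤ K := fun k hk => by simpa [hs] using hk
  set G : (s → ℝ) × EuclideanSpace ℝ (Fin n) → ℝ≥0∞ := fun q =>
    F (Function.updateFinset (fun _ => nextKnot X i K q.2) s q.1, q.2) with hG
  have hGm : Measurable G := by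
    refine hF.comp (Measurable.prodMk (measurable_pi_iff.2 fun k => ?_) measurable_snd)
    unfold Function.updateFinset
    split_ifs
    · exact (measurable_pi_apply _).comp measurable_fst
    · exact (measurable_nextKnot X i K).comp measurable_snd
  have hlaw := map_inner_prod_starProjection μ₀ σ s (knotDir X i) (colSpan X i K)
    (fun k hk => colSpan_mono X i (hmem k hk).2 (knotDir_mem X i (hmem k hk).1))
    (fun k hk l hl h => inner_knotDir_knotDir X i (hmem k hk).1 (hmem l hl).1 h)
  calc ∫⁻ y, F (pathVec X i K y, (colSpan X i K)ᗮ.starProjection y) ∂isoGaussian μ₀ σ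
      = ∫⁻ y, G ((fun k : s => ⟪knotDir X i k, y⟫), (colSpan X i K)ᗮ.starProjection y)
          ∂isoGaussian μ₀ σ := by
        refine lintegral_congr fun y => ?_
        simp only [hG, nextKnot_starProjection]
        rfl
    _ = ∫⁻ q, G q ∂(isoGaussian μ₀ σ).map fun y =>
          ((fun k : s => ⟪knotDir X i k, y⟫), (colSpan X i K)ᗮ.starProjection y) := by
        rw [lintegral_map hGm (by fun_prop)]
    _ = _ := by
        rw [hlaw, lintegral_prod_symm _ hGm.aemeasurable]
        rfl

/-- On the event that the sequence of knots is nonincreasing, the conditional tail probability is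
uniform and independent of any event that does not involve the knots strictly between `a`
and `c`. -/
lemma lintegral_tailProb_pathVec (hab : a < b) (hbc : b < c) (hcK : c ≤ K + 1)
    (hirr : IrrCheck X i K) (hσ : 0 < σ)
    {T : Set ((ℕ → ℝ) × EuclideanSpace ℝ (Fin n))} (hT : MeasurableSet T)
    (hTd : ∀ w, DependsOn (fun x => (x, w) ∈ T) (Set.Icc 1 a)) {B : Set ℝ} (hB : MeasurableSet B) :
    ∫⁻ y, B.indicator 1 (tailProb (knotLaw X i μ₀ σ) a b c (pathVec X i K y)) *
        (T.indicator 1 (pathVec X i K y, (colSpan X i K)ᗮ.starProjection y) *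
          decrInd 0 (K + 1) (pathVec X i K y)) ∂isoGaussian μ₀ σ =
      volume.restrict (Set.Ioo (0 : ℝ) 1) B *
        ∫⁻ y, T.indicator 1 (pathVec X i K y, (colSpan X i K)ᗮ.starProjection y) *
          decrInd 0 (K + 1) (pathVec X i K y) ∂isoGaussian μ₀ σ := by
  set γ := knotLaw X i μ₀ σ with hγ
  have hTi : Measurable (T.indicator (1 : (ℕ → ℝ) × EuclideanSpace ℝ (Fin n) → ℝ≥0∞)) :=
    measurable_one.indicator hT
  have hBi : Measurable (B.indicator (1 : ℝ → ℝ≥0∞)) := measurable_one.indicator hB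
  have hgm : Measurable fun q : (ℕ → ℝ) × EuclideanSpace ℝ (Fin n) =>
      T.indicator (1 : (ℕ → ℝ) × EuclideanSpace ℝ (Fin n) → ℝ≥0∞) q * decrInd 0 (K + 1) q.1 :=
    hTi.mul ((measurable_decrInd _ _).comp measurable_fst)
  have hfm : Measurable fun q : (ℕ → ℝ) × EuclideanSpace ℝ (Fin n) =>
      B.indicator (1 : ℝ → ℝ≥0∞) (tailProb γ a b c q.1) *
        (T.indicator (1 : (ℕ → ℝ) × EuclideanSpace ℝ (Fin n) → ℝ≥0∞) q * decrInd 0 (K + 1) q.1) :=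
    (hBi.comp ((measurable_tailProb γ a b c).comp measurable_fst)).mul hgm
  have : NullSingletonClass (γ b) := by
    obtain ⟨q, rfl⟩ : ∃ q, b = q + 1 := ⟨b - 1, by omega⟩
    refine nullSingletonClass_gaussianReal ?_
    have := norm_pos_iff.2 (knotDir_ne_zero hirr (by omega : q < K))
    have : 0 < σ ^ 2 * ‖knotDir X i (q + 1)‖ ^ 2 := by positivity
    simpa using this
  refine (lintegral_pathVec hfm).trans ?_
  refine Eq.trans ?_ (congrArg _ (lintegral_pathVec hgm).symm)
  have hlm : ∀ q : (ℕ → ℝ) × EuclideanSpace ℝ (Fin n) → ℝ≥0∞, Measurable q → ∀ w,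
      Measurable fun x => q (x, w) := fun q hq w => hq.comp (measurable_id.prodMk measurable_const)
  rw [← lintegral_const_mul' _ _ (measure_ne_top _ _)]
  refine lintegral_congr fun w => ?_
  have hsub : Finset.Ioo a c ⊆ Finset.Icc 1 K := fun k hk => by
    rw [Finset.mem_Ioo] at hk; rw [Finset.mem_Icc]; omega
  have hconst : ∀ (s : Finset ℕ) (g : (ℕ → ℝ) → ℝ≥0∞), Measurable g → ∀ x,
      (∫⋯∫⁻_s, (fun x => volume.restrict (Set.Ioo (0 : ℝ) 1) B * g x) ∂γ) x =
        volume.restrict (Set.Ioo (0 : ℝ) 1) B * (∫⋯∫⁻_s, g ∂γ) x := fun s g hg x =>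
    lmarginal_mul_of_dependsOn γ (f := fun _ => volume.restrict (Set.Ioo (0 : ℝ) 1) B)
      (fun _ _ _ => rfl) hg x
  rw [← hconst _ _ (hlm _ hgm w)]
  refine congrFun (lmarginal_eq_of_subset hsub (hlm _ hfm w) ((hlm _ hgm w).const_mul _) ?_) _
  funext x
  rw [hconst _ _ (hlm _ hgm w)]
  -- factor out the constraints outside the interval between `a` and `c`
  set ψ : (ℕ → ℝ) → ℝ≥0∞ := fun x =>
    T.indicator 1 (x, w) * (decrInd 0 a x * decrInd c (K + 1) x) with hψ
  have hψm : Measurable ψ := (hlm _ hTi w).mul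
    ((measurable_decrInd 0 a).mul (measurable_decrInd c (K + 1)))
  have hψd : DependsOn ψ (Set.Ioo a c)ᶜ := by
    intro x x' hx
    have h1 : decrInd 0 a x = decrInd 0 a x' := dependsOn_decrInd 0 a fun k hk =>
      hx k fun h => by have := hk.2; have := h.1; omega
    have h2 : decrInd c (K + 1) x = decrInd c (K + 1) x' := dependsOn_decrInd c (K + 1) fun k hk =>
      hx k fun h => by have := hk.1; have := h.2; omega
    have h3 : ((x, w) ∈ T) = ((x', w) ∈ T) := hTd w fun k hk =>
      hx k fun h => by have := hk.2; have := h.1; omega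
    have h4 : T.indicator (1 : (ℕ → ℝ) × EuclideanSpace ℝ (Fin n) → ℝ≥0∞) (x, w) =
        T.indicator 1 (x', w) := by
      by_cases h : (x, w) ∈ T
      · rw [Set.indicator_of_mem h, Set.indicator_of_mem (h3 ▸ h)]; rfl
      · rw [Set.indicator_of_notMem h, Set.indicator_of_notMem (h3 ▸ h)]
    simp only [hψ, h1, h2, h4]
  have hsplit : ∀ x, T.indicator 1 (x, w) * decrInd 0 (K + 1) x = ψ x * decrInd a c x := by
    intro x
    rw [decrInd_mul (Nat.zero_le a) (by omega : a ≤ K + 1),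
      decrInd_mul (hab.trans hbc).le hcK]
    simp only [hψ]
    ring
  simp only [hsplit, ← mul_assoc]
  exact lmarginal_tailProb γ hab hbc hψm hψd hB x

/-- Along a sequence, an event about the first `a` knots, the signed variables and the variance
estimate does not involve the later knots up to the `K`-th. -/
lemma exists_set_of_knots (hirr : IrrCheck X i K) (hKp : K < p) (haK : a ≤ K) (n₁ : ℕ)
    {B : (Fin (K + 1) → SignedVar p) → Set ((Fin a → ℝ) × ℝ)} (hB : ∀ v, MeasurableSet (B v)) :
    ∃ T : Set ((ℕ → ℝ) × EuclideanSpace ℝ (Fin n)), MeasurableSet T ∧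
      (∀ w, DependsOn (fun x => (x, w) ∈ T) (Set.Icc 1 a)) ∧
      ∀ y, (∀ k ∈ Set.Icc 1 K, index X y k = i k) →
        (((fun k : Fin a => knot X y (k + 1)), sigmaSelect X K n₁ y) ∈
            B (fun k : Fin (K + 1) => index X y (k + 1)) ↔
          (pathVec X i K y, (colSpan X i K)ᗮ.starProjection y) ∈ T) := by
  set D : SignedVar p → Set ((ℕ → ℝ) × EuclideanSpace ℝ (Fin n)) := fun v =>
    {q | ((fun k : Fin a => q.1 (k + 1)),
      ‖(E1 X (Function.update i (K + 1) v) (K + 1) n₁).starProjection q.2‖ / √n₁) ∈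
        B (fun k : Fin (K + 1) => Function.update i (K + 1) v (k + 1))} with hD
  have hDm : ∀ v, MeasurableSet (D v) := fun v => by
    have : Measurable fun q : (ℕ → ℝ) × EuclideanSpace ℝ (Fin n) =>
        ((fun k : Fin a => q.1 (k + 1)),
          ‖(E1 X (Function.update i (K + 1) v) (K + 1) n₁).starProjection q.2‖ / √n₁) := by
      fun_prop
    exact this (hB _)
  refine ⟨{q | q ∈ D (nextVar X i K q.2)}, ?_, ?_, ?_⟩
  · exact measurableSet_mem_of_countable
      (fun v => measurable_snd (measurableSet_nextVar_eq X i K v)) hDm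
  · intro w x x' hx
    have : (fun k : Fin a => x (k + 1)) = fun k : Fin a => x' (k + 1) := by
      funext k
      exact hx _ ⟨by omega, by omega⟩
    simp only [hD, Set.mem_ofPred_eq, this]
  · intro y h
    obtain ⟨hknot, -⟩ := knot_eq_pathVec hirr hKp h
    have hidx := index_eq_update hirr hKp h
    have h1 : (fun k : Fin a => knot X y (k + 1)) =
        fun k : Fin a => pathVec X i K y (k + 1) := by
      funext k
      exact hknot _ ⟨by omega, by omega⟩
    have h2 : (fun k : Fin (K + 1) => index X y (k + 1)) =
        fun k : Fin (K + 1) => Function.update i (K + 1) (nextVar X i K y) (k + 1) := by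
      funext k
      exact hidx _ ⟨by omega, by omega⟩
    have h3 : sigmaSelect X K n₁ y =
        ‖(E1 X (Function.update i (K + 1) (nextVar X i K y)) (K + 1) n₁).starProjection
          ((colSpan X i K)ᗮ.starProjection y)‖ / √n₁ := by
      have hup : ∀ l ∈ Set.Icc 1 K, i l = Function.update i (K + 1) (nextVar X i K y) l :=
        fun l hl => (Function.update_of_ne (by have := hl.2; omega) _ _).symm
      rw [starProjection_E1 X hup, sigmaSelect]
      simp only [E1_congr X hidx]
    simp only [hD, Set.mem_ofPred_eq, nextVar_starProjection, h1, h2, h3]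

/-- Along a sequence, `{m̂ = a}` is an event about the first `a` knots and the part of the
observation orthogonal to the first `K` columns. -/
lemma StoppingRule.exists_set {Ω : Type*} {Y : Ω → EuclideanSpace ℝ (Fin n)} {m : Ω → ℕ} {n₁ : ℕ}
    (hm : StoppingRule X K n₁ Y m) (hirr : IrrCheck X i K) (hKp : K < p) (haK : a < K) :
    ∃ T : Set ((ℕ → ℝ) × EuclideanSpace ℝ (Fin n)), MeasurableSet T ∧
      (∀ w, DependsOn (fun x => (x, w) ∈ T) (Set.Icc 1 a)) ∧
      ∀ ω, (∀ k ∈ Set.Icc 1 K, index X (Y ω) k = i k) →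
        (m ω = a ↔ (pathVec X i K (Y ω), (colSpan X i K)ᗮ.starProjection (Y ω)) ∈ T) := by
  have hle : ∀ q < K, ∃ T : Set ((ℕ → ℝ) × EuclideanSpace ℝ (Fin n)), MeasurableSet T ∧
      (∀ w, DependsOn (fun x => (x, w) ∈ T) (Set.Icc 1 q)) ∧
      ∀ ω, (∀ k ∈ Set.Icc 1 K, index X (Y ω) k = i k) →
        (m ω ≤ q ↔ (pathVec X i K (Y ω), (colSpan X i K)ᗮ.starProjection (Y ω)) ∈ T) := by
    intro q hq
    obtain ⟨B, hB, hmB⟩ := hm.2 q hq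
    obtain ⟨T, hT, hTd, hTy⟩ := exists_set_of_knots hirr hKp hq.le n₁ hB
    exact ⟨T, hT, hTd, fun ω h => (hmB ω).trans (hTy _ h)⟩
  obtain ⟨T, hT, hTd, hTm⟩ := hle a haK
  rcases Nat.eq_zero_or_pos a with rfl | ha
  · exact ⟨T, hT, hTd, fun ω h => by rw [← hTm ω h, Nat.le_zero]⟩
  · obtain ⟨T', hT', hTd', hTm'⟩ := hle (a - 1) (by omega)
    refine ⟨T \ T', hT.diff hT', fun w x x' hx => ?_, fun ω h => ?_⟩
    · have h1 : ((x, w) ∈ T) = ((x', w) ∈ T) := hTd w hx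
      have h2 : ((x, w) ∈ T') = ((x', w) ∈ T') := hTd' w fun k hk =>
        hx k ⟨hk.1, hk.2.trans (Nat.sub_le a 1)⟩
      simp only [Set.mem_sdiff, h1, h2]
    · rw [Set.mem_sdiff, ← hTm ω h, ← hTm' ω h]
      omega

/-- The unnormalized conditional law of the p-value given `m̂ = a` and the first `K` signed
variables. The event is, up to a null set, the preimage under `Y` of a Borel set; neither `m` nor
`Y` is assumed measurable on the nose. -/
lemma map_alphaHat_restrict {Ω : Type*} [MeasurableSpace Ω] {P : Measure Ω}
    {Y : Ω → EuclideanSpace ℝ (Fin n)} (hY : AEMeasurable Y P) (hlaw : P.map Y = isoGaussian μ₀ σ)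
    (hσ : 0 < σ) {m : Ω → ℕ} {n₁ : ℕ} (hm : StoppingRule X K n₁ Y m) (hKr : K < X.rank)
    (hab : a < b) (hbc : b < c) (hcK : c ≤ K + 1) (hirr : IrrCheck X i K)
    (hμ : μ₀ ∈ colSpan X i a) :
    NullMeasurableSet {ω | m ω = a ∧ ∀ k ∈ Set.Icc 1 K, index X (Y ω) k = i k} P ∧
      AEMeasurable (fun ω => alphaHat X σ a b c (Y ω))
        (P.restrict {ω | m ω = a ∧ ∀ k ∈ Set.Icc 1 K, index X (Y ω) k = i k}) ∧
      (P.restrict {ω | m ω = a ∧ ∀ k ∈ Set.Icc 1 K, index X (Y ω) k = i k}).map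
          (fun ω => alphaHat X σ a b c (Y ω)) =
        P {ω | m ω = a ∧ ∀ k ∈ Set.Icc 1 K, index X (Y ω) k = i k} •
          volume.restrict (Set.Ioo (0 : ℝ) 1) := by
  have hKp : K < p := hKr.trans_le (by simpa using X.rank_le_width)
  set E : Set Ω := {ω | m ω = a ∧ ∀ k ∈ Set.Icc 1 K, index X (Y ω) k = i k} with hE
  obtain ⟨T, hT, hTd, hTm⟩ := hm.exists_set hirr hKp (by omega : a < K)
  set D : Set (EuclideanSpace ℝ (Fin n)) :=
    {y | (pathVec X i K y, (colSpan X i K)ᗮ.starProjection y) ∈ T} ∩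
      pathVec X i K ⁻¹' decr 0 (K + 1) with hD
  have hpath := measurable_pathVec X i K
  have hDm : MeasurableSet D := by
    have : Measurable fun y => (pathVec X i K y, (colSpan X i K)ᗮ.starProjection y) :=
      hpath.prodMk (by fun_prop)
    exact (this hT).inter (hpath (measurableSet_decr _ _))
  have hae : ∀ᵐ ω ∂P, (∀ k ∈ Set.Icc 1 K, pathVec X i K (Y ω) (k + 1) ≠ pathVec X i K (Y ω) k) ∧
      0 < nextKnot X i K (Y ω) := by
    have h := ae_pathVec (μ₀ := μ₀) hirr hKr hKp hσ
    rw [← hlaw] at h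
    exact ae_of_ae_map hY h
  have hED : E =ᵐ[P] Y ⁻¹' D := by
    filter_upwards [hae] with ω hω
    refine propext ?_
    change ω ∈ E ↔ Y ω ∈ D
    constructor
    · rintro ⟨h1, h2⟩
      exact ⟨(hTm ω h2).1 h1, (knot_eq_pathVec hirr hKp h2).2⟩
    · rintro ⟨h1, h2⟩
      have hidx : ∀ k ∈ Set.Icc 1 K, index X (Y ω) k = i k := by
        refine index_eq_of_pathVec hirr hKp fun k hk => lt_of_le_of_ne ?_ (hω.1 k hk)
        have := h2 k ⟨Nat.zero_le k, Nat.lt_succ_of_le hk.2⟩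
        rw [knotSeq_of_pos (by omega), knotSeq_of_pos (by have := hk.1; omega)] at this
        exact_mod_cast this
      exact ⟨(hTm ω hidx).2 h1, hidx⟩
  have hYD : NullMeasurableSet (Y ⁻¹' D) P := hY.nullMeasurableSet_preimage hDm
  have hEn : NullMeasurableSet E P := hYD.congr hED.symm
  have htm : Measurable fun y => tailProb (knotLaw X i μ₀ σ) a b c (pathVec X i K y) :=
    (measurable_tailProb _ a b c).comp hpath
  have heq : (fun ω => alphaHat X σ a b c (Y ω)) =ᵐ[P.restrict E]
      fun ω => tailProb (knotLaw X i μ₀ σ) a b c (pathVec X i K (Y ω)) := by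
    refine (ae_restrict_iff'₀ hEn).2 ?_
    filter_upwards [hae] with ω hω hωE
    exact alphaHat_eq_tailProb hirr hKp hσ hμ hab hbc hcK hωE.2 hω.2
  have htY : AEMeasurable (fun ω => tailProb (knotLaw X i μ₀ σ) a b c (pathVec X i K (Y ω))) P :=
    htm.comp_aemeasurable hY
  refine ⟨hEn, htY.restrict.congr heq.symm, ?_⟩
  rw [Measure.map_congr heq]
  have hind : ∀ y, D.indicator (1 : EuclideanSpace ℝ (Fin n) → ℝ≥0∞) y =
      T.indicator 1 (pathVec X i K y, (colSpan X i K)ᗮ.starProjection y) *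
        decrInd 0 (K + 1) (pathVec X i K y) := fun y => by
    rw [hD, Set.inter_indicator_one]
    rfl
  have hPE : P E = ∫⁻ y, D.indicator 1 y ∂isoGaussian μ₀ σ := by
    rw [measure_congr hED, lintegral_indicator_one hDm, ← hlaw,
      Measure.map_apply_of_aemeasurable hY hDm]
  ext B hB
  rw [Measure.map_apply_of_aemeasurable htY.restrict hB, Measure.restrict_congr_set hED,
    Measure.restrict_apply₀' hYD, Measure.smul_apply, smul_eq_mul]
  have hset : (fun ω => tailProb (knotLaw X i μ₀ σ) a b c (pathVec X i K (Y ω))) ⁻¹' B ∩ Y ⁻¹' D =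
      Y ⁻¹' ((fun y => tailProb (knotLaw X i μ₀ σ) a b c (pathVec X i K y)) ⁻¹' B ∩ D) := rfl
  rw [hset, ← Measure.map_apply_of_aemeasurable hY ((htm hB).inter hDm), hlaw,
    ← lintegral_indicator_one ((htm hB).inter hDm), hPE]
  simp only [hind]
  rw [mul_comm, ← lintegral_tailProb_pathVec hab hbc hcK hirr hσ hT hTd hB]
  refine lintegral_congr fun y => ?_
  rw [Set.inter_indicator_one, Pi.mul_apply, hind]
  rfl

end Sequence

/-! ### Conditioning on the selection event -/

lemma hasLaw_cond_of_map_restrict {Ω : Type*} [MeasurableSpace Ω] {P : Measure Ω}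
    [IsProbabilityMeasure P] {E : Set Ω} {f : Ω → ℝ} {U : Measure ℝ}
    (hf : AEMeasurable f (P.restrict E)) (hmap : (P.restrict E).map f = P E • U) (hE : P E ≠ 0) :
    HasLaw f U (ProbabilityTheory.cond P E) where
  aemeasurable := hf.smul_measure _
  map_eq := by
    rw [ProbabilityTheory.cond, Measure.map_smul, hmap, smul_smul,
      ENNReal.inv_mul_cancel hE (measure_ne_top P E), one_smul]

/-- A conditional law common to countably many disjoint events is the conditional law given their
union. -/
lemma map_restrict_iUnion {Ω ι : Type*} [MeasurableSpace Ω] [Countable ι] {P : Measure Ω}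
    {E : ι → Set Ω} (hE : ∀ i, NullMeasurableSet (E i) P)
    (hd : Pairwise (Function.onFun Disjoint E)) {f : Ω → ℝ} {U : Measure ℝ}
    (hf : ∀ i, AEMeasurable f (P.restrict (E i)))
    (hmap : ∀ i, (P.restrict (E i)).map f = P (E i) • U) :
    AEMeasurable f (P.restrict (⋃ i, E i)) ∧
      (P.restrict (⋃ i, E i)).map f = P (⋃ i, E i) • U := by
  have hd' : Pairwise (Function.onFun (AEDisjoint P) E) := fun i j hij => (hd hij).aedisjoint
  have hfU : AEMeasurable f (P.restrict (⋃ i, E i)) := aemeasurable_iUnion_iff.2 hf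
  refine ⟨hfU, ?_⟩
  ext B hB
  rw [Measure.restrict_iUnion_ae hd' hE] at hfU ⊢
  rw [Measure.map_apply_of_aemeasurable hfU hB,
    Measure.sum_apply₀ _ (hfU.nullMeasurableSet_preimage hB), Measure.smul_apply,
    measure_iUnion₀ hd' hE, smul_eq_mul, ← ENNReal.tsum_mul_right]
  refine tsum_congr fun i => ?_
  rw [← Measure.map_apply_of_aemeasurable (hf i) hB, hmap, Measure.smul_apply, smul_eq_mul]

/-- A finite sequence of signed variables as a sequence indexed from `1`, with an arbitrary value
outside `1, …, K`. -/
def extendSeq {p K : ℕ} [NeZero p] (q : Fin K → SignedVar p) (k : ℕ) : SignedVar p :=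
  if h : k ∈ Set.Icc 1 K then q ⟨k - 1, by have := h.1; have := h.2; omega⟩ else (0, 1)

lemma extendSeq_eq {p K : ℕ} [NeZero p] (i : ℕ → SignedVar p) {k : ℕ} (hk : k ∈ Set.Icc 1 K) :
    extendSeq (fun l : Fin K => i (l + 1)) k = i k := by
  rw [extendSeq, dif_pos hk]
  congr 1
  have := hk.1
  simp only
  omega

end LAR

end

theorem theorem2 {Ω : Type*} [MeasurableSpace Ω] (P : Measure Ω) [IsProbabilityMeasure P]
    {n p : ℕ} [NeZero p] (X : Matrix (Fin n) (Fin p) ℝ) (β₀ : Fin p → ℝ)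
    (σ : ℝ) (hσ : 0 < σ) (η Y : Ω → EuclideanSpace ℝ (Fin n))
    (hη : HasLaw η (multivariateGaussian 0 ((σ ^ 2) • (1 : Matrix (Fin n) (Fin n) ℝ))) P)
    (hY : ∀ ω, Y ω = WithLp.toLp 2 (X *ᵥ β₀) + η ω)
    (K n₁ n₂ : ℕ) (hK : 1 ≤ K) (hKn : K + 3 < n) (hKr : K < X.rank)
    (hn₁ : 1 ≤ n₁) (hn₂ : 1 ≤ n₂) (hn : n = n₁ + n₂ + (K + 1))
    (m : Ω → ℕ) (hm : LAR.StoppingRule X K n₁ Y m)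
    (a b c : ℕ) (hab : a < b) (hbc : b < c) (hcK : c ≤ K + 1) :
    -- conditional on `m̂ = a`, the null hypothesis and the Irrepresentable Check
    (let E : Set Ω := {ω | m ω = a ∧
        WithLp.toLp 2 (X *ᵥ β₀) ∈ LAR.colSpan X (LAR.index X (Y ω)) a ∧
        LAR.IrrCheck X (LAR.index X (Y ω)) K};
      P E ≠ 0 →
        HasLaw (fun ω => LAR.alphaHat X σ a b c (Y ω))
          (volume.restrict (Set.Ioo (0 : ℝ) 1)) (ProbabilityTheory.cond P E)) ∧
    -- the same conditional on `m̂ = a` and on the selected signed variables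
    (∀ i : ℕ → LAR.SignedVar p, LAR.IrrCheck X i K →
      WithLp.toLp 2 (X *ᵥ β₀) ∈ LAR.colSpan X i a →
      let E : Set Ω := {ω | m ω = a ∧ ∀ k ∈ Set.Icc 1 K, LAR.index X (Y ω) k = i k};
      P E ≠ 0 →
        HasLaw (fun ω => LAR.alphaHat X σ a b c (Y ω))
          (volume.restrict (Set.Ioo (0 : ℝ) 1)) (ProbabilityTheory.cond P E)) := by
  set μ₀ : EuclideanSpace ℝ (Fin n) := WithLp.toLp 2 (X *ᵥ β₀) with hμ₀
  have hYη : Y = fun ω => μ₀ + η ω := funext hY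
  have hYm : AEMeasurable Y P := by
    rw [hYη]
    exact hη.aemeasurable.const_add μ₀
  have hlaw : P.map Y = LAR.isoGaussian μ₀ σ := by
    rw [← LAR.map_const_add_isoGaussian, LAR.isoGaussian, ← hη.map_eq,
      AEMeasurable.map_map_of_aemeasurable (by fun_prop) hη.aemeasurable, hYη]
    rfl
  have hcore := fun (i : ℕ → LAR.SignedVar p) (hirr : LAR.IrrCheck X i K)
      (hμ : μ₀ ∈ LAR.colSpan X i a) =>
    LAR.map_alphaHat_restrict hYm hlaw hσ hm hKr hab hbc hcK hirr hμ
  constructor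
  · intro E hE
    -- split according to the first `K` signed variables
    let Q := {q : Fin K → LAR.SignedVar p //
      LAR.IrrCheck X (LAR.extendSeq q) K ∧ μ₀ ∈ LAR.colSpan X (LAR.extendSeq q) a}
    let F : Q → Set Ω := fun q =>
      {ω | m ω = a ∧ ∀ k ∈ Set.Icc 1 K, LAR.index X (Y ω) k = LAR.extendSeq q.1 k}
    have hext : ∀ ω, ∀ k ∈ Set.Icc 1 K,
        LAR.index X (Y ω) k =
          LAR.extendSeq (fun l : Fin K => LAR.index X (Y ω) (l + 1)) k :=
      fun ω k hk => (LAR.extendSeq_eq (LAR.index X (Y ω)) hk).symm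
    have haK : a ≤ K := by omega
    have hEF : E = ⋃ q, F q := by
      ext ω
      rw [Set.mem_iUnion]
      constructor
      · rintro ⟨h1, h2, h3⟩
        refine ⟨⟨fun l : Fin K => LAR.index X (Y ω) (l + 1), h3.congr (hext ω), ?_⟩, h1, hext ω⟩
        rwa [← LAR.colSpan_congr X fun l hl => hext ω l ⟨hl.1, hl.2.trans haK⟩]
      · rintro ⟨⟨q, h2, h3⟩, h1, h⟩
        refine ⟨h1, ?_, h2.congr fun k hk => (h k hk).symm⟩
        rwa [LAR.colSpan_congr X fun l hl => h l ⟨hl.1, hl.2.trans haK⟩]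
    have hdisj : Pairwise (Function.onFun Disjoint F) := by
      intro q q' hqq'
      refine Set.disjoint_left.2 fun ω hω hω' => hqq' (Subtype.ext (funext fun l => ?_))
      have hl : (l : ℕ) + 1 ∈ Set.Icc 1 K := ⟨by omega, by omega⟩
      have h := (hω.2 _ hl).symm.trans (hω'.2 _ hl)
      simpa only [LAR.extendSeq, dif_pos hl, Nat.add_sub_cancel] using h
    have h := LAR.map_restrict_iUnion (P := P) (E := F)
      (fun q => (hcore _ q.2.1 q.2.2).1) hdisj
      (fun q => (hcore _ q.2.1 q.2.2).2.1) (fun q => (hcore _ q.2.1 q.2.2).2.2)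
    rw [← hEF] at h
    exact LAR.hasLaw_cond_of_map_restrict h.1 h.2 hE
  · intro i hirr hμ E hE
    obtain ⟨-, h1, h2⟩ := hcore i hirr hμ
    exact LAR.hasLaw_cond_of_map_restrict h1 h2 hE
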